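/- Let $0\le k<n$, let $g_1,\dots,g_m\in C^\infty(\mathbb R^n;\mathbb R^n)$ and $x_0\in\mathbb R^n$. Let $\Lambda=L(g_1,\dots,g_m)$ be the smallest real vector space of smooth vector fields on $\mathbb R^n$ that contains $g_1,\dots,g_m$ and is closed under the Lie bracket $[X,Y]=\frac{\partial Y}{\partial x}X-\frac{\partial X}{\partial x}Y$, and for $x\in\mathbb R^n$ put $\Lambda(x)=\{X(x):X\in\Lambda\}$. An orbit of $\Lambda$ with origin $x_0$ is a map $$y(p)=G_1(t_1)\circ\cdots\circ G_N(t_N)(x_0),\qquad p=(t_1,\dots,t_N)\in D_N=\prod_{i=1}^N[-a_i,a_i],\quad a_i>0,\ N\ge 0,$$ where $G_i(t)(x)$ ($|t|<T_i$, $x\in U$, with $T_i>a_i$ and $U$ an open neighbourhood of $x_0$ common to all $i$) is the (smooth) local flow of some $X_i\in\Lambda$, and where for every $p\in D_N$ each flow is applied to a point of $U$. A system of generators of $\Lambda$ (with respect to the orbits of origin $x_0$) is a finite family $Y_1,\dots,Y_M\in\Lambda$ such that for every orbit $y:D_N\to\mathbb R^n$ of origin $x_0$ and every $Z\in\Lambda$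 there are $c_1,\dots,c_M\in C^\infty(D_N;\mathbb R)$ with $Z(y(p))=\sum_{j=1}^M c_j(p)\,Y_j(y(p))$ for all $p\in D_N$. $\Lambda$ is finitely generated with respect to the orbits of origin $x_0$ if a system of generators exists. Theorem. Assume that $L(g_1,\dots,g_m)$ is finitely generated with respect to the orbits of origin $x_0$ and that $\dim L(g_1,\dots,g_m)(x_0)=k<n$. Then there are systems of generators $Y_1,\dots,Y_M$ ($M\ge k$) such that $$(\ast)\qquad Y_1(x_0),\dots,Y_k(x_0)\ \text{are linearly independent and}\ Y_j(x_0)=0\ \text{for } k<j\le M .$$ Moreover, let $Y_1,\dots,Y_M$ be any system of generators with $(\ast)$, let $y(p)=G_1(t_1)\circ\cdots\circ G_M(t_M)(x_0)$, $p\in D_M$, be any orbit in which $G_i$ is a local flow of $Y_i$ for $i=1,\dots,M$, let $\rho>0$, and put $V(x_0)=\{x\in B(x_0,\rho): x=y(p)\text{ for some }p\in D_M\}$. Then there are $n-k\ge 1$ functions $\varphi_{k+1},\dots,\varphi_n\in C^\infty(B(x_0,\rho);\mathbb R)$ such that 1. no $\varphi_j$ is constant on $B(x_0,\rho)$, and the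 gradients $\partial_x\varphi_{k+1}(x_0),\dots,\partial_x\varphi_n(x_0)$ are linearly independent; 2. each $\varphi_j$ vanishes on $V(x_0)$ and solves the system there: $$\langle\partial_x\varphi_j(x),g_i(x)\rangle=0\qquad\text{for all }x\in V(x_0),\ i=1,\dots,m;$$ 3. for some $\alpha>0$ the set $M_{x_0}=\{G_1(t_1)\circ\cdots\circ G_k(t_k)(x_0): |t_i|<\alpha,\ i=1,\dots,k\}$ is contained in $V(x_0)$ and is a $k$-dimensional smooth embedded submanifold of $\mathbb R^n$, and for some $\delta>0$ $$V(x_0)\cap B(x_0,\delta)=M_{x_0}\cap B(x_0,\delta)=\{x\in B(x_0,\delta):\varphi_{k+1}(x)=\cdots=\varphi_n(x)=0\}.$$ -/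

import Mathlib

open Set Metric
open scoped ContDiff InnerProductSpace Gradient

noncomputable section

/-- The Euclidean space `ℝⁿ`. -/
abbrev Rn (n : ℕ) : Type := EuclideanSpace ℝ (Fin n)

/-- `L(g₁, …, g_m)`: the smallest real linear space of smooth vector fields on `ℝⁿ` that contains
`g₁, …, g_m` and is closed under the Lie bracket `[X, Y] = (∂Y/∂x) X - (∂X/∂x) Y`. -/
def generatedLieAlgebra {n m : ℕ} (g : Fin m → Rn n → Rn n) : Submodule ℝ (Rn n → Rn n) :=
  sInf {N | (∀ X ∈ N, ContDiff ℝ ∞ X) ∧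
    (∀ X ∈ N, ∀ Y ∈ N, VectorField.lieBracket ℝ X Y ∈ N) ∧ ∀ i, g i ∈ N}

/-- `Λ(x) = {X(x) : X ∈ Λ}`, a linear subspace of `ℝⁿ`. -/
def valuesAt {n : ℕ} (Λ : Submodule ℝ (Rn n → Rn n)) (x : Rn n) : Submodule ℝ (Rn n) :=
  Λ.map (LinearMap.proj x : (Rn n → Rn n) →ₗ[ℝ] Rn n)

/-- `G(t)(x)`, `|t| < T`, `x ∈ U`, is the local (smooth) flow of the vector field `X`. -/
structure IsLocalFlow {n : ℕ} (X : Rn n → Rn n) (T : ℝ) (U : Set (Rn n))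
    (G : ℝ → Rn n → Rn n) : Prop where
  smooth : ContDiffOn ℝ ∞ (fun q : ℝ × Rn n => G q.1 q.2) (Ioo (-T) T ×ˢ U)
  initial : ∀ x ∈ U, G 0 x = x
  ode : ∀ x ∈ U, ∀ t ∈ Ioo (-T) T, HasDerivAt (fun s => G s x) (X (G t x)) t

/-- The points `z_j = G_j(t_j) ∘ ⋯ ∘ G_{N-1}(t_{N-1}) (x)`, `j = 0, …, N` (so `z_N = x`). -/
def partialComp {n N : ℕ} (G : Fin N → ℝ → Rn n → Rn n) (t : Fin N → ℝ) (x : Rn n) :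
    Fin (N + 1) → Rn n :=
  Fin.reverseInduction (motive := fun _ => Rn n) x (fun j z => G j (t j) z)

/-- The full composition `G_0(t_0) ∘ ⋯ ∘ G_{N-1}(t_{N-1}) (x)`. -/
def flowComp {n N : ℕ} (G : Fin N → ℝ → Rn n → Rn n) (x : Rn n) (t : Fin N → ℝ) : Rn n :=
  partialComp G t x 0

/-- `t ↦ flowComp G x₀ t`, `t ∈ ∏ [-aᵢ, aᵢ]`, is an orbit of `Λ` with origin `x₀`: each `G_i` is
the local flow, on a common neighbourhood `U` of `x₀`, of some `X_i ∈ Λ`, and the composition is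
well defined, that is, each flow is applied to a point of `U`. -/
structure IsOrbit {n N : ℕ} (Λ : Submodule ℝ (Rn n → Rn n)) (x₀ : Rn n)
    (X : Fin N → Rn n → Rn n) (a : Fin N → ℝ) (U : Set (Rn n))
    (G : Fin N → ℝ → Rn n → Rn n) : Prop where
  mem : ∀ i, X i ∈ Λ
  isOpen : IsOpen U
  origin_mem : x₀ ∈ U
  pos : ∀ i, 0 < a i
  flow : ∀ i, ∃ T, a i < T ∧ IsLocalFlow (X i) T U (G i)
  stays : ∀ t ∈ Icc (-a) a, ∀ j : Fin N, partialComp G t x₀ j.succ ∈ U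

/-- `Y₁, …, Y_M ∈ Λ` is a system of generators of `Λ` along the orbits of origin `x₀`: along every
orbit, every `Z ∈ Λ` is a combination of the `Y_j` whose coefficients are smooth functions of the
orbit parameters. -/
def IsGeneratingSystem {n M : ℕ} (Λ : Submodule ℝ (Rn n → Rn n)) (x₀ : Rn n)
    (Y : Fin M → Rn n → Rn n) : Prop :=
  (∀ j, Y j ∈ Λ) ∧
  ∀ Z ∈ Λ, ∀ (N : ℕ) (X : Fin N → Rn n → Rn n) (a : Fin N → ℝ) (U : Set (Rn n))
    (G : Fin N → ℝ → Rn n → Rn n), IsOrbit Λ x₀ X a U G →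
    ∃ c : Fin M → (Fin N → ℝ) → ℝ, (∀ j, ContDiffOn ℝ ∞ (c j) (Icc (-a) a)) ∧
      ∀ p ∈ Icc (-a) a, Z (flowComp G x₀ p) = ∑ j, c j p • Y j (flowComp G x₀ p)

/-- `Λ` is finitely generated with respect to the orbits of origin `x₀`. -/
def IsFinitelyGeneratedAlongOrbits {n : ℕ} (Λ : Submodule ℝ (Rn n → Rn n)) (x₀ : Rn n) : Prop :=
  ∃ (M : ℕ) (Y : Fin M → Rn n → Rn n), IsGeneratingSystem Λ x₀ Y

/-- `S` is a `k`-dimensional smooth (embedded) submanifold of `ℝⁿ`: near each of its points it is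
the zero set of a smooth submersion to `ℝⁿ⁻ᵏ`. -/
def IsSmoothSubmanifold {n : ℕ} (k : ℕ) (S : Set (Rn n)) : Prop :=
  k ≤ n ∧ ∀ x ∈ S, ∃ (W : Set (Rn n)) (f : Rn n → Rn (n - k)), IsOpen W ∧ x ∈ W ∧
    ContDiffOn ℝ ∞ f W ∧ (∀ y ∈ W, Function.Surjective (fderiv ℝ f y)) ∧
    S ∩ W = {y ∈ W | f y = 0}

/-- `V(x₀)`: the points of `B(x₀, ρ)` on the orbit. -/
def orbitSet {n N : ℕ} (G : Fin N → ℝ → Rn n → Rn n) (a : Fin N → ℝ) (x₀ : Rn n) (ρ : ℝ) :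
    Set (Rn n) :=
  {x ∈ ball x₀ ρ | ∃ p ∈ Icc (-a) a, x = flowComp G x₀ p}

/-- The points `G₁(t₁) ∘ ⋯ ∘ G_k(t_k) (x₀)`, `|tᵢ| < α`, obtained from the first `k` flows. -/
def orbitManifold {n k r : ℕ} (G : Fin (k + r) → ℝ → Rn n → Rn n) (x₀ : Rn n) (α : ℝ) :
    Set (Rn n) :=
  {x | ∃ t : Fin k → ℝ, (∀ i, |t i| < α) ∧ x = flowComp (fun i => G (Fin.castAdd r i)) x₀ t}

end

/-! Let `J` be the spatial derivative of the flow of some `X ∈ Λ`. The pulled-back generators `J⁻¹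
Y_i` have time derivative `J⁻¹ [X, Y_i]`, and finite generation turns this into a linear combination
of the `J⁻¹ Y_j` with continuous coefficients. Their span is therefore constant in time: flows carry
`Λ(x)` isomorphically onto `Λ` at the image point (`map_span_eq`, `map_valuesAt`). Consequently `dim
Λ = k` along every orbit, and every parameter derivative of an orbit is tangent to `Λ`.

The first `k` flows form an immersion `F` near `0`. Adding transversal coordinates gives a
submersion `f` whose zero set is the image of `F`; the tangent spaces of this image are the `Λ(x)`,
so `df` kills `Λ` there.

The main difficulty is that every point of the orbit near `x₀`, whatever its parameters, satisfies
`f = 0`. The functions `df(Y_i)` vanish on the zero set of `f`, hence are `O(‖f‖)` near `x₀`. Where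
`dim Λ(x) = k`, the fields `Y_1, …, Y_k` span `Λ(x)` with bounded coordinates, so `‖df(v)‖ ≤ C ‖f‖
‖v‖` on `Λ(x)`, and Grönwall along a parameter segment starting at a preimage of `x₀` gives `f = 0`.
Multiplying the components of `f` by a bump function yields the `φ_j`. -/

/-! ### Linear differential equations -/

/-- Grönwall: a function with `‖f'‖ ≤ K ‖f‖` that vanishes somewhere on an interval vanishes
on the whole interval. -/
theorem eq_zero_of_norm_deriv_le_of_mem_Icc {E : Type*} [NormedAddCommGroup E] [NormedSpace ℝ E]
    {f f' : ℝ → E} {K a b t₀ : ℝ} (hf : ∀ t ∈ Icc a b, HasDerivAt f (f' t) t)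
    (hK : ∀ t ∈ Icc a b, ‖f' t‖ ≤ K * ‖f t‖) (ht₀ : t₀ ∈ Icc a b) (h0 : f t₀ = 0) :
    ∀ t ∈ Icc a b, f t = 0 := by
  intro t ht
  rcases le_total t₀ t with h | h
  · refine eq_zero_of_abs_deriv_le_mul_abs_self_of_eq_zero_right (f' := f') (K := K) (a := t₀)
      (b := b) ?_ ?_ h0 ?_ t ⟨h, ht.2⟩
    · exact fun s hs => (hf s ⟨ht₀.1.trans hs.1, hs.2⟩).continuousAt.continuousWithinAt
    · exact fun s hs => (hf s ⟨ht₀.1.trans hs.1, hs.2.le⟩).hasDerivWithinAt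
    · exact fun s hs => hK s ⟨ht₀.1.trans hs.1, hs.2.le⟩
  -- Times before `t₀` are handled by reversing time.
  · have hm : ∀ s ∈ Icc (-t₀) (-a), -s ∈ Icc a b := fun s hs =>
      ⟨by linarith [hs.2], by linarith [hs.1, ht₀.2]⟩
    have hd : ∀ s ∈ Icc (-t₀) (-a), HasDerivAt (fun s => f (-s)) (-f' (-s)) s := fun s hs => by
      simpa [Function.comp_def] using (hf _ (hm s hs)).scomp s (hasDerivAt_neg s)
    have := eq_zero_of_abs_deriv_le_mul_abs_self_of_eq_zero_right (f := fun s => f (-s))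
      (f' := fun s => -f' (-s)) (K := K) (a := -t₀) (b := -a)
      (fun s hs => (hd s hs).continuousAt.continuousWithinAt)
      (fun s hs => (hd s ⟨hs.1, hs.2.le⟩).hasDerivWithinAt) (by simpa using h0)
      (fun s hs => by simpa using hK _ (hm s ⟨hs.1, hs.2.le⟩)) (-t) ⟨by linarith, by linarith [ht.1]⟩
    simpa using this

/-- Solutions of a linear system `V' = C(t) V` stay in the span of their values at any time. -/
theorem mem_span_range_of_linear_ode {E ι : Type*} [NormedAddCommGroup E] [NormedSpace ℝ E]
    [FiniteDimensional ℝ E] [Fintype ι] {V : ℝ → ι → E} {c : ι → ι → ℝ → ℝ} {a b t₀ t : ℝ}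
    (hc : ∀ i j, ContinuousOn (c i j) (Icc a b))
    (hV : ∀ s ∈ Icc a b, ∀ i, HasDerivAt (fun s => V s i) (∑ j, c i j s • V s j) s)
    (ht₀ : t₀ ∈ Icc a b) (ht : t ∈ Icc a b) (i : ι) :
    V t i ∈ Submodule.span ℝ (range (V t₀)) := by
  by_contra hcon
  -- Take a functional `f` that kills the span at `t₀` but not `V t i`. The scalars `f (V s j)`
  -- solve the same linear system and all vanish at `t₀`, hence at `t`.
  obtain ⟨f, hf, hf0⟩ := Submodule.exists_dual_map_eq_bot_of_notMem hcon inferInstance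
  have hker : ∀ j, f (V t₀ j) = 0 := fun j => by
    have : f (V t₀ j) ∈ (Submodule.span ℝ (range (V t₀))).map f :=
      Submodule.mem_map_of_mem (Submodule.subset_span ⟨j, rfl⟩)
    rwa [hf0, Submodule.mem_bot] at this
  choose C hC using fun i j => isCompact_Icc.exists_bound_of_continuousOn (hc i j)
  have hC0 : ∀ i j, 0 ≤ C i j := fun i j => (norm_nonneg _).trans (hC i j t₀ ht₀)
  have hzero := eq_zero_of_norm_deriv_le_of_mem_Icc (f := fun s i => f (V s i))
    (f' := fun s i => ∑ j, c i j s • f (V s j)) (K := ∑ i, ∑ j, C i j) (a := a) (b := b) (t₀ := t₀)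
    (fun s hs => hasDerivAt_pi.2 fun i => by
      have := (LinearMap.toContinuousLinearMap f).hasFDerivAt.comp_hasDerivAt s (hV s hs i)
      simpa [Function.comp_def] using this)
    (fun s hs => by
      have hKn : 0 ≤ ∑ i, ∑ j, C i j :=
        Finset.sum_nonneg fun i _ => Finset.sum_nonneg fun j _ => hC0 i j
      refine (pi_norm_le_iff_of_nonneg (by positivity)).2 fun i => ?_
      calc ‖∑ j, c i j s • f (V s j)‖ ≤ ∑ j, C i j * ‖fun i => f (V s i)‖ := by
            refine norm_sum_le_of_le _ fun j _ => ?_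
            rw [norm_smul]
            exact mul_le_mul (hC i j s hs) (norm_le_pi_norm (fun i => f (V s i)) j)
              (norm_nonneg _) (hC0 i j)
        _ = (∑ j, C i j) * ‖fun i => f (V s i)‖ := by rw [Finset.sum_mul]
        _ ≤ _ := mul_le_mul_of_nonneg_right (Finset.single_le_sum
            (f := fun i => ∑ j, C i j) (fun i _ => Finset.sum_nonneg fun j _ => hC0 i j)
            (Finset.mem_univ i)) (norm_nonneg _))
    ht₀ (funext hker) t ht
  exact hf (congrFun hzero i)

/-- If `∂q/∂t = X(q)`, then the partial derivative of `q` in space solves the equation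
`J' = DX(q) J`. -/
theorem hasDerivAt_fderiv_comp_inr {E : Type*} [NormedAddCommGroup E] [NormedSpace ℝ E]
    {q : ℝ × E → E} {X : E → E} {t : ℝ} {z : E} (hq : ContDiffAt ℝ 2 q (t, z))
    (hX : DifferentiableAt ℝ X (q (t, z)))
    (hev : ∀ᶠ p in nhds (t, z), fderiv ℝ q p (1, 0) = X (q p)) :
    HasDerivAt (fun s => (fderiv ℝ q (s, z)).comp (ContinuousLinearMap.inr ℝ ℝ E))
      ((fderiv ℝ X (q (t, z))).comp ((fderiv ℝ q (t, z)).comp (ContinuousLinearMap.inr ℝ ℝ E)))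
      t := by
  obtain ⟨D, hD⟩ : ∃ D, D = fderiv ℝ (fderiv ℝ q) (t, z) := ⟨_, rfl⟩
  have hd : HasFDerivAt (fderiv ℝ q) D (t, z) :=
    hD ▸ ((hq.fderiv_right (m := 1) (by norm_num)).differentiableAt (by simp)).hasFDerivAt
  have h2 : HasDerivAt (fun s : ℝ => (s, z)) ((1 : ℝ), (0 : E)) t :=
    (hasDerivAt_id t).prodMk (hasDerivAt_const t z)
  have h3 : HasDerivAt (fun s => (fderiv ℝ q (s, z)).comp (ContinuousLinearMap.inr ℝ ℝ E))
      ((D (1, 0)).comp (ContinuousLinearMap.inr ℝ ℝ E)) t :=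
    ((ContinuousLinearMap.compL ℝ E (ℝ × E) E).flip
      (ContinuousLinearMap.inr ℝ ℝ E)).hasFDerivAt.comp_hasDerivAt t (hd.comp_hasDerivAt t h2)
  refine h3.congr_deriv ?_
  ext1 w
  -- Symmetry of `D` exchanges the time and space derivatives, after which it suffices to
  -- differentiate `∂q/∂t = X(q)` in the direction `w`.
  have hsymm : IsSymmSndFDerivAt ℝ q (t, z) := hq.isSymmSndFDerivAt (by simp)
  have h4 : HasFDerivAt (fun p => fderiv ℝ q p (1, 0)) (D.flip (1, 0)) (t, z) :=
    (ContinuousLinearMap.apply ℝ E ((1 : ℝ), (0 : E))).hasFDerivAt.comp (t, z) hd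
  have h5 := hX.hasFDerivAt.comp (t, z) (hq.differentiableAt (by simp)).hasFDerivAt
  have h6 := DFunLike.congr_fun (h4.unique (h5.congr_of_eventuallyEq hev)) (0, w)
  have h7 := hsymm (1, 0) (0, w)
  rw [← hD] at h7
  exact h7.trans h6

/-! ### Spatial derivatives of flows -/

namespace IsLocalFlow

variable {n : ℕ} {X : Rn n → Rn n} {T : ℝ} {U : Set (Rn n)} {G : ℝ → Rn n → Rn n}

theorem contDiffAt (h : IsLocalFlow X T U G) (hU : IsOpen U) {t : ℝ} {z : Rn n}
    (ht : t ∈ Ioo (-T) T) (hz : z ∈ U) :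
    ContDiffAt ℝ ∞ (fun q : ℝ × Rn n => G q.1 q.2) (t, z) :=
  h.smooth.contDiffAt ((isOpen_Ioo.prod hU).mem_nhds ⟨ht, hz⟩)

theorem fderiv_time (h : IsLocalFlow X T U G) (hU : IsOpen U) {t : ℝ} {z : Rn n}
    (ht : t ∈ Ioo (-T) T) (hz : z ∈ U) :
    fderiv ℝ (fun q : ℝ × Rn n => G q.1 q.2) (t, z) (1, 0) = X (G t z) := by
  have h1 := ((h.contDiffAt hU ht hz).differentiableAt (by simp)).hasFDerivAt
  have h2 : HasDerivAt (fun s : ℝ => (s, z)) ((1 : ℝ), (0 : Rn n)) t :=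
    (hasDerivAt_id t).prodMk (hasDerivAt_const t z)
  have h3 := h1.comp_hasDerivAt t h2
  exact h3.unique (h.ode z hz t ht)

/-- The spatial derivative of a flow solves the variational equation. -/
theorem hasDerivAt_fderiv_space (h : IsLocalFlow X T U G) (hU : IsOpen U) (hX : ContDiff ℝ ∞ X)
    {t : ℝ} {z : Rn n} (ht : t ∈ Ioo (-T) T) (hz : z ∈ U) :
    HasDerivAt (fun s => (fderiv ℝ (fun q : ℝ × Rn n => G q.1 q.2) (s, z)).comp
        (ContinuousLinearMap.inr ℝ ℝ (Rn n)))
      ((fderiv ℝ X (G t z)).comp ((fderiv ℝ (fun q : ℝ × Rn n => G q.1 q.2) (t, z)).comp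
        (ContinuousLinearMap.inr ℝ ℝ (Rn n)))) t := by
  refine hasDerivAt_fderiv_comp_inr (q := fun q : ℝ × Rn n => G q.1 q.2)
    ((h.contDiffAt hU ht hz).of_le ENat.LEInfty.out)
    (hX.differentiable (by simp) _) ?_
  filter_upwards [(isOpen_Ioo.prod hU).mem_nhds ⟨ht, hz⟩] with p hp
  exact h.fderiv_time hU hp.1 hp.2

theorem fderiv_space_zero (h : IsLocalFlow X T U G) (hU : IsOpen U) (hT : 0 < T)
    {z : Rn n} (hz : z ∈ U) :
    (fderiv ℝ (fun q : ℝ × Rn n => G q.1 q.2) (0, z)).comp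
        (ContinuousLinearMap.inr ℝ ℝ (Rn n)) = ContinuousLinearMap.id ℝ (Rn n) := by
  have h0 : (0 : ℝ) ∈ Ioo (-T) T := ⟨by linarith, hT⟩
  have h1 := ((h.contDiffAt hU h0 hz).differentiableAt (by simp)).hasFDerivAt
  have h2 := h1.comp z (hasFDerivAt_prodMk_right (𝕜 := ℝ) (0 : ℝ) z)
  refine h2.unique ((hasFDerivAt_id z).congr_of_eventuallyEq ?_)
  filter_upwards [hU.mem_nhds hz] with x hx
  exact h.initial x hx

/-- If `J(t) w = 0`, then `s ↦ J(s) w` solves a linear equation and vanishes at `s = t`, so it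
vanishes at `s = 0`, where `J` is the identity. -/
theorem isUnit_fderiv_space (h : IsLocalFlow X T U G) (hU : IsOpen U) (hX : ContDiff ℝ ∞ X)
    {t : ℝ} {z : Rn n} (ht : t ∈ Ioo (-T) T) (hz : z ∈ U) :
    IsUnit ((fderiv ℝ (fun q : ℝ × Rn n => G q.1 q.2) (t, z)).comp
        (ContinuousLinearMap.inr ℝ ℝ (Rn n))) := by
  have hT : 0 < T := by linarith [ht.1, ht.2]
  rw [ContinuousLinearMap.isUnit_iff_isUnit_toLinearMap, LinearMap.isUnit_iff_ker_eq_bot,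
    LinearMap.ker_eq_bot']
  intro w hw
  have hsub : ∀ s ∈ Icc (-|t|) |t|, s ∈ Ioo (-T) T := fun s hs =>
    ⟨by linarith [hs.1, abs_lt.2 ht], by linarith [hs.2, abs_lt.2 ht]⟩
  have hcont : ContinuousOn (fun s => ‖fderiv ℝ X (G s z)‖) (Icc (-|t|) |t|) := fun s hs =>
    (((hX.continuous_fderiv (by simp)).continuousAt.comp
      (h.ode z hz s (hsub s hs)).continuousAt).norm).continuousWithinAt
  obtain ⟨K, hK⟩ := isCompact_Icc.exists_bound_of_continuousOn hcont
  have := eq_zero_of_norm_deriv_le_of_mem_Icc (K := K) (a := -|t|) (b := |t|) (t₀ := t)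
    (fun s hs => (h.hasDerivAt_fderiv_space hU hX (hsub s hs) hz).clm_apply (hasDerivAt_const s w))
    (fun s hs => by
      rw [map_zero, add_zero, ContinuousLinearMap.comp_apply]
      refine (ContinuousLinearMap.le_opNorm _ _).trans ?_
      exact mul_le_mul_of_nonneg_right (by simpa using hK s hs) (norm_nonneg _))
    ⟨neg_abs_le t, le_abs_self t⟩ hw 0 ⟨by simp, by simp⟩
  rwa [h.fderiv_space_zero hU hT hz] at this

/-- If the brackets `[X, Y_j]` are combinations of the `Y_l` along a trajectory of `X`, then the
flow of `X` carries the span of the `Y_j` at the origin onto their span at the end point. -/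
theorem map_span_eq {ι : Type*} [Fintype ι] (h : IsLocalFlow X T U G) (hU : IsOpen U)
    (hX : ContDiff ℝ ∞ X) {a : ℝ} (haT : a < T) {z : Rn n} (hz : z ∈ U)
    {Y : ι → Rn n → Rn n} (hY : ∀ j, ContDiff ℝ ∞ (Y j)) {c : ι → ι → ℝ → ℝ}
    (hc : ∀ i j, ContinuousOn (c i j) (Icc (-a) a))
    (hbr : ∀ s ∈ Icc (-a) a, ∀ i,
      VectorField.lieBracket ℝ X (Y i) (G s z) = ∑ j, c i j s • Y j (G s z))
    {t : ℝ} (ht : t ∈ Icc (-a) a) :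
    (Submodule.span ℝ (range fun j => Y j z)).map
      ((fderiv ℝ (fun q : ℝ × Rn n => G q.1 q.2) (t, z)).comp
        (ContinuousLinearMap.inr ℝ ℝ (Rn n))).toLinearMap =
      Submodule.span ℝ (range fun j => Y j (G t z)) := by
  set J : ℝ → Rn n →L[ℝ] Rn n := fun s =>
    (fderiv ℝ (fun q : ℝ × Rn n => G q.1 q.2) (s, z)).comp (ContinuousLinearMap.inr ℝ ℝ (Rn n))
    with hJ
  have hsub : ∀ s ∈ Icc (-a) a, s ∈ Ioo (-T) T := fun s hs =>
    ⟨by linarith [hs.1], by linarith [hs.2]⟩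
  have hunit : ∀ s ∈ Icc (-a) a, IsUnit (J s) := fun s hs =>
    h.isUnit_fderiv_space hU hX (hsub s hs) hz
  have hT : 0 < T := by linarith [(hsub t ht).1, (hsub t ht).2]
  have hinv : ∀ s ∈ Icc (-a) a, ∀ v, J s (Ring.inverse (J s) v) = v := fun s hs v =>
    DFunLike.congr_fun (Ring.mul_inverse_cancel _ (hunit s hs)) v
  have hinv' : ∀ s ∈ Icc (-a) a, ∀ v, Ring.inverse (J s) (J s v) = v := fun s hs v =>
    DFunLike.congr_fun (Ring.inverse_mul_cancel _ (hunit s hs)) v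
  -- Since `(J⁻¹)' = -J⁻¹ DX` and `(Y_i(G))' = DY_i X`, the derivative of `J⁻¹ Y_i(G)` is `J⁻¹ [X,
  -- Y_i]`, and `hbr` closes the system.
  have hder : ∀ s ∈ Icc (-a) a, ∀ i, HasDerivAt (fun s => Ring.inverse (J s) (Y i (G s z)))
      (∑ j, c i j s • Ring.inverse (J s) (Y j (G s z))) s := by
    intro s hs i
    have h1 : HasDerivAt J ((fderiv ℝ X (G s z)).comp (J s)) s :=
      h.hasDerivAt_fderiv_space hU hX (hsub s hs) hz
    obtain ⟨u, hu⟩ := hunit s hs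
    have h2 := hasFDerivAt_ringInverse (𝕜 := ℝ) u
    rw [hu] at h2
    have h3 := h2.comp_hasDerivAt s h1
    have h4 := (((hY i).differentiable (by simp)) (G s z)).hasFDerivAt.comp_hasDerivAt s
      (h.ode z hz s (hsub s hs))
    have h5 := h3.clm_apply h4
    refine h5.congr_deriv ?_
    have hui : (↑u⁻¹ : Rn n →L[ℝ] Rn n) = Ring.inverse (J s) := by
      rw [← hu, Ring.inverse_unit]
    have h6 := congrArg (fun v => Ring.inverse (J s) v) (hbr s hs i)
    simp only [VectorField.lieBracket, map_sub, map_sum, map_smul] at h6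
    simp only [Function.comp_apply]
    rw [← h6, hui]
    simp [hinv s hs]
    abel
  have h0 : (0 : ℝ) ∈ Icc (-a) a := ⟨by linarith [ht.1, ht.2], by linarith [ht.1, ht.2]⟩
  have hJ0 : Ring.inverse (J 0) = 1 := by
    have : J 0 = 1 := h.fderiv_space_zero hU hT hz
    rw [this, Ring.inverse_one]
  have hV0 : ∀ j, Ring.inverse (J 0) (Y j (G 0 z)) = Y j z := fun j => by
    rw [hJ0, h.initial z hz]; rfl
  -- The span of the pulled-back fields is the same at times `0` and `t`; each inclusion follows one
  -- time direction.
  apply le_antisymm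
  · rw [Submodule.map_span_le]
    rintro _ ⟨i, rfl⟩
    have := mem_span_range_of_linear_ode (V := fun s i => Ring.inverse (J s) (Y i (G s z)))
      hc hder ht h0 i
    have := Submodule.mem_map_of_mem (f := (J t).toLinearMap) this
    rw [Submodule.map_span, ← range_comp] at this
    simp only [Function.comp_def, hV0, ContinuousLinearMap.coe_coe, hinv t ht] at this
    exact this
  · rw [Submodule.span_le]
    rintro _ ⟨i, rfl⟩
    have := mem_span_range_of_linear_ode (V := fun s i => Ring.inverse (J s) (Y i (G s z)))
      hc hder h0 ht i
    refine ⟨_, ?_, hinv t ht _⟩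
    simpa [hV0] using this

end IsLocalFlow

/-! ### The generated Lie algebra -/

section generatedLieAlgebra

variable {n m : ℕ} {g : Fin m → Rn n → Rn n}

/-- Smoothness of the `g i` makes the space of all smooth fields a member of the intersected family;
otherwise that family is empty and its infimum is `⊤`. -/
theorem contDiff_of_mem_generatedLieAlgebra (hg : ∀ i, ContDiff ℝ ∞ (g i)) {X : Rn n → Rn n}
    (hX : X ∈ generatedLieAlgebra g) : ContDiff ℝ ∞ X := by
  let N : Submodule ℝ (Rn n → Rn n) :=
    { carrier := {X | ContDiff ℝ ∞ X}
      add_mem' := fun {X Y} (h₁ : ContDiff ℝ ∞ X) (h₂ : ContDiff ℝ ∞ Y) => h₁.add h₂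
      zero_mem' := show ContDiff ℝ ∞ fun _ => (0 : Rn n) from contDiff_const
      smul_mem' := fun c X (h : ContDiff ℝ ∞ X) => h.const_smul c }
  refine (Submodule.mem_sInf.1 hX) N ⟨fun X h => h, fun X h₁ Y h₂ => ?_, hg⟩
  exact ContDiff.lieBracket_vectorField (m := ∞) (n := ∞) h₁ h₂ le_rfl

theorem lieBracket_mem_generatedLieAlgebra {X Y : Rn n → Rn n}
    (hX : X ∈ generatedLieAlgebra g) (hY : Y ∈ generatedLieAlgebra g) :
    VectorField.lieBracket ℝ X Y ∈ generatedLieAlgebra g :=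
  Submodule.mem_sInf.2 fun N hN =>
    hN.2.1 X (Submodule.mem_sInf.1 hX N hN) Y (Submodule.mem_sInf.1 hY N hN)

theorem mem_generatedLieAlgebra (i : Fin m) : g i ∈ generatedLieAlgebra g :=
  Submodule.mem_sInf.2 fun _ hN => hN.2.2 i

end generatedLieAlgebra

theorem apply_mem_valuesAt {n : ℕ} {Λ : Submodule ℝ (Rn n → Rn n)} {X : Rn n → Rn n} (hX : X ∈ Λ)
    (x : Rn n) : X x ∈ valuesAt Λ x :=
  ⟨X, hX, rfl⟩

/-! ### Compositions of flows -/

section partialComp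

variable {n N : ℕ} (G : Fin N → ℝ → Rn n → Rn n) (t : Fin N → ℝ) (x : Rn n)

@[simp]
theorem partialComp_last : partialComp G t x (Fin.last N) = x :=
  Fin.reverseInduction_last

@[simp]
theorem partialComp_castSucc (j : Fin N) :
    partialComp G t x j.castSucc = G j (t j) (partialComp G t x j.succ) :=
  Fin.reverseInduction_castSucc _

/-- The recursion determines the partial compositions. -/
theorem eq_partialComp {z : Fin (N + 1) → Rn n} (h0 : z (Fin.last N) = x)
    (hs : ∀ j : Fin N, z j.castSucc = G j (t j) (z j.succ)) : z = partialComp G t x := by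
  funext j
  induction j using Fin.reverseInduction with
  | last => simp [h0]
  | cast j ih => rw [hs, ih, partialComp_castSucc]

theorem flowComp_fin_zero (G : Fin 0 → ℝ → Rn n → Rn n) (t : Fin 0 → ℝ) : flowComp G x t = x :=
  partialComp_last G t x

theorem partialComp_tail (G : Fin (N + 1) → ℝ → Rn n → Rn n) (t : Fin (N + 1) → ℝ)
    (j : Fin (N + 1)) :
    partialComp (fun i => G i.succ) (Fin.tail t) x j = partialComp G t x j.succ := by
  refine (congrFun (eq_partialComp (fun i => G i.succ) (Fin.tail t) x
    (z := fun j => partialComp G t x j.succ) ?_ fun j => ?_) j).symm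
  · simp
  · simp only [Fin.succ_castSucc, partialComp_castSucc, Fin.tail]

/-- The outermost flow has index `0`, so peeling it off leaves an orbit with one parameter fewer;
the inductions on orbits below rest on this. -/
theorem flowComp_succ (G : Fin (N + 1) → ℝ → Rn n → Rn n) (t : Fin (N + 1) → ℝ) :
    flowComp G x t = G 0 (t 0) (flowComp (fun i => G i.succ) x (Fin.tail t)) := by
  rw [flowComp, flowComp, partialComp_tail]
  exact partialComp_castSucc G t x 0

/-- Trailing flows taken at time `0` may be dropped. -/
theorem flowComp_append_zero {k r : ℕ} (G : Fin (k + r) → ℝ → Rn n → Rn n)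
    (h0 : ∀ i, G (Fin.natAdd k i) 0 x = x) (t : Fin k → ℝ) :
    flowComp G x (Fin.append t 0) = flowComp (fun i => G (Fin.castAdd r i)) x t := by
  have hx : ∀ i : Fin (r + 1), partialComp G (Fin.append t 0) x (Fin.natAdd k i) = x := by
    intro i
    induction i using Fin.reverseInduction with
    | last => exact partialComp_last G _ x
    | cast i ih =>
      have := partialComp_castSucc G (Fin.append t 0) x (Fin.natAdd k i)
      rw [Fin.append_right, Pi.zero_apply] at this
      exact this.trans ((congrArg (G (Fin.natAdd k i) 0) ih).trans (h0 i))
  refine congrFun (eq_partialComp (fun i => G (Fin.castAdd r i)) t x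
    (z := fun j => partialComp G (Fin.append t 0) x (Fin.castLE (by omega) j)) ?_ fun j => ?_) 0
  · exact hx 0
  · have := partialComp_castSucc G (Fin.append t 0) x (Fin.castAdd r j)
    rw [Fin.append_left] at this
    exact this

end partialComp

theorem cons_tail_mem_Icc {N : ℕ} {a p : Fin (N + 1) → ℝ} (hp : p ∈ Icc (-a) a) {s : ℝ}
    (hs : s ∈ Icc (-a 0) (a 0)) : Fin.cons s (Fin.tail p) ∈ Icc (-a) a := by
  constructor <;> intro i <;> refine Fin.cases ?_ (fun i => ?_) i
  · simpa using hs.1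
  · simpa [Fin.tail] using hp.1 i.succ
  · simpa using hs.2
  · simpa [Fin.tail] using hp.2 i.succ

/-! ### Transport of `Λ` along orbits -/

namespace IsOrbit

variable {n N : ℕ} {Λ : Submodule ℝ (Rn n → Rn n)} {x₀ : Rn n}

theorem tail {X : Fin (N + 1) → Rn n → Rn n} {a : Fin (N + 1) → ℝ} {U : Set (Rn n)}
    {G : Fin (N + 1) → ℝ → Rn n → Rn n} (h : IsOrbit Λ x₀ X a U G) :
    IsOrbit Λ x₀ (fun i => X i.succ) (Fin.tail a) U (fun i => G i.succ) where
  mem i := h.mem _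
  isOpen := h.isOpen
  origin_mem := h.origin_mem
  pos i := h.pos _
  flow i := h.flow _
  stays t ht j := by
    -- Any admissible time for the removed flow would do, since it does not affect the later points;
    -- `0` is admissible because `0 < a 0`.
    have := h.stays (Fin.cons 0 t) ?_ j.succ
    · rwa [← partialComp_tail, Fin.tail_cons] at this
    · have ha : ∀ i, 0 ≤ a i := fun i => (h.pos i).le
      constructor <;> intro i <;> refine Fin.cases ?_ (fun i => ?_) i
      · simpa using ha 0
      · simpa [Fin.tail] using ht.1 i
      · simpa using ha 0
      · simpa [Fin.tail] using ht.2 i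

end IsOrbit

namespace IsGeneratingSystem

variable {n M N : ℕ} {Λ : Submodule ℝ (Rn n → Rn n)} {x₀ : Rn n} {Y : Fin M → Rn n → Rn n}

theorem valuesAt_eq_span (hY : IsGeneratingSystem Λ x₀ Y) {X : Fin N → Rn n → Rn n}
    {a : Fin N → ℝ} {U : Set (Rn n)} {G : Fin N → ℝ → Rn n → Rn n} (h : IsOrbit Λ x₀ X a U G)
    {p : Fin N → ℝ} (hp : p ∈ Icc (-a) a) :
    valuesAt Λ (flowComp G x₀ p) = Submodule.span ℝ (range fun j => Y j (flowComp G x₀ p)) := by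
  apply le_antisymm
  · rintro _ ⟨Z, hZ, rfl⟩
    obtain ⟨c, -, hc⟩ := hY.2 Z hZ N X a U G h
    rw [LinearMap.proj_apply, hc p hp]
    exact Submodule.sum_mem _ fun j _ => Submodule.smul_mem _ _ (Submodule.subset_span ⟨j, rfl⟩)
  · rw [Submodule.span_le]
    rintro _ ⟨j, rfl⟩
    exact apply_mem_valuesAt (hY.1 j) _

/-- The first flow of an orbit carries `Λ` at one partial composition onto `Λ` at the next. -/
theorem map_valuesAt (hY : IsGeneratingSystem Λ x₀ Y) (hsm : ∀ X ∈ Λ, ContDiff ℝ ∞ X)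
    (hbr : ∀ X ∈ Λ, ∀ Y ∈ Λ, VectorField.lieBracket ℝ X Y ∈ Λ)
    {X : Fin (N + 1) → Rn n → Rn n} {a : Fin (N + 1) → ℝ} {U : Set (Rn n)}
    {G : Fin (N + 1) → ℝ → Rn n → Rn n} (h : IsOrbit Λ x₀ X a U G) {p : Fin (N + 1) → ℝ}
    (hp : p ∈ Icc (-a) a) :
    (valuesAt Λ (flowComp (fun i => G i.succ) x₀ (Fin.tail p))).map
      ((fderiv ℝ (fun q : ℝ × Rn n => G 0 q.1 q.2)
        (p 0, flowComp (fun i => G i.succ) x₀ (Fin.tail p))).comp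
        (ContinuousLinearMap.inr ℝ ℝ (Rn n))).toLinearMap = valuesAt Λ (flowComp G x₀ p) := by
  have hp0 : p 0 ∈ Icc (-a 0) (a 0) := ⟨hp.1 0, hp.2 0⟩
  have hpt : Fin.tail p ∈ Icc (-Fin.tail a) (Fin.tail a) := ⟨fun i => hp.1 _, fun i => hp.2 _⟩
  have hz : flowComp (fun i => G i.succ) x₀ (Fin.tail p) ∈ U := by
    have := h.stays p hp 0
    rwa [← partialComp_tail] at this
  obtain ⟨T, haT, hG⟩ := h.flow 0
  -- The brackets `[X 0, Y i]` lie in `Λ`, so they have coefficients along the whole orbit; freezing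
  -- every parameter but the first gives the coefficients on a single trajectory.
  choose c hc hcs using fun i => hY.2 _ (hbr _ (h.mem 0) _ (hY.1 i)) _ X a U G h
  have key : ∀ s, flowComp G x₀ (Fin.cons s (Fin.tail p)) =
      G 0 s (flowComp (fun i => G i.succ) x₀ (Fin.tail p)) := fun s => by
    rw [flowComp_succ, Fin.tail_cons, Fin.cons_zero]
  rw [hY.valuesAt_eq_span h.tail hpt, hY.valuesAt_eq_span h hp,
    flowComp_succ x₀ G p]
  refine hG.map_span_eq h.isOpen (hsm _ (h.mem 0)) haT hz (fun j => hsm _ (hY.1 j))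
    (c := fun i j s => c i j (Fin.cons s (Fin.tail p))) (fun i j => ?_) (fun s hs i => ?_) hp0
  · refine (hc i j).continuousOn.comp (Continuous.continuousOn ?_)
      fun s hs => cons_tail_mem_Icc hp hs
    refine continuous_pi fun i => Fin.cases ?_ (fun i => ?_) i
    · exact continuous_id
    · exact continuous_const
  · have := hcs i _ (cons_tail_mem_Icc hp hs)
    rwa [key] at this

end IsGeneratingSystem

namespace IsOrbit

variable {n M N : ℕ} {Λ : Submodule ℝ (Rn n → Rn n)} {x₀ : Rn n} {X : Fin N → Rn n → Rn n}
  {a : Fin N → ℝ} {U : Set (Rn n)} {G : Fin N → ℝ → Rn n → Rn n} {p : Fin N → ℝ}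

/-- Chain rule for the outermost flow: its own parameter contributes the field at the end point, and
the other parameters act through the spatial derivative. -/
theorem hasFDerivAt_succ {X : Fin (N + 1) → Rn n → Rn n} {a : Fin (N + 1) → ℝ}
    {G : Fin (N + 1) → ℝ → Rn n → Rn n} (h : IsOrbit Λ x₀ X a U G) {p : Fin (N + 1) → ℝ}
    (hp : p ∈ Icc (-a) a)
    (hd : ContDiffAt ℝ ∞ (flowComp (fun i => G i.succ) x₀) (Fin.tail p)) :
    ContDiffAt ℝ ∞ (flowComp G x₀) p ∧ ∀ v, fderiv ℝ (flowComp G x₀) p v =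
      v 0 • X 0 (flowComp G x₀ p) + (fderiv ℝ (fun q : ℝ × Rn n => G 0 q.1 q.2)
        (p 0, flowComp (fun i => G i.succ) x₀ (Fin.tail p))).comp
        (ContinuousLinearMap.inr ℝ ℝ (Rn n))
        (fderiv ℝ (flowComp (fun i => G i.succ) x₀) (Fin.tail p) (Fin.tail v)) := by
  have hz : flowComp (fun i => G i.succ) x₀ (Fin.tail p) ∈ U := by
    have := h.stays p hp 0
    rwa [← partialComp_tail] at this
  obtain ⟨T, haT, hG⟩ := h.flow 0
  have hp0 : p 0 ∈ Ioo (-T) T :=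
    ⟨by linarith [show -a 0 ≤ p 0 from hp.1 0], by linarith [show p 0 ≤ a 0 from hp.2 0]⟩
  have hq := hG.contDiffAt h.isOpen hp0 hz
  let τ : (Fin (N + 1) → ℝ) →L[ℝ] (Fin N → ℝ) :=
    ContinuousLinearMap.pi fun i => ContinuousLinearMap.proj i.succ
  let ε : (Fin (N + 1) → ℝ) →L[ℝ] ℝ := ContinuousLinearMap.proj 0
  have heq : flowComp G x₀ = (fun q : ℝ × Rn n => G 0 q.1 q.2) ∘
      fun p => (ε p, flowComp (fun i => G i.succ) x₀ (τ p)) := by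
    funext p; exact flowComp_succ x₀ G p
  have hin : ContDiffAt ℝ ∞ (fun p => (ε p, flowComp (fun i => G i.succ) x₀ (τ p))) p :=
    ε.contDiff.contDiffAt.prodMk (hd.comp p τ.contDiff.contDiffAt)
  have hin' : HasFDerivAt (fun p => (ε p, flowComp (fun i => G i.succ) x₀ (τ p)))
      (ε.prod ((fderiv ℝ (flowComp (fun i => G i.succ) x₀) (Fin.tail p)).comp τ)) p :=
    ε.hasFDerivAt.prodMk ((hd.differentiableAt (by simp)).hasFDerivAt.comp p τ.hasFDerivAt)
  refine ⟨by rw [heq]; exact ContDiffAt.comp p hq hin, fun v => ?_⟩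
  have hfd := ((hq.differentiableAt (by simp)).hasFDerivAt.comp p hin').fderiv
  rw [flowComp_succ x₀ G p, ← hG.fderiv_time h.isOpen hp0 hz, heq, hfd, ← map_smul]
  simp only [ContinuousLinearMap.comp_apply, ContinuousLinearMap.inr_apply, ← map_add]
  congr 1
  ext1 <;> simp [ε, τ]
  rfl

/-- This includes the boundary of the box: each flow exists beyond `a i` and `U` is open, so
ordinary derivatives can be used throughout. -/
theorem contDiffAt (h : IsOrbit Λ x₀ X a U G) (hp : p ∈ Icc (-a) a) :
    ContDiffAt ℝ ∞ (flowComp G x₀) p := by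
  induction N with
  | zero =>
    have : flowComp G x₀ = fun _ => x₀ := funext fun t => flowComp_fin_zero x₀ G t
    rw [this]
    exact contDiffAt_const
  | succ N ih =>
    exact (h.hasFDerivAt_succ hp (ih h.tail ⟨fun i => hp.1 _, fun i => hp.2 _⟩)).1

theorem zero_mem_Icc (h : IsOrbit Λ x₀ X a U G) : (0 : Fin N → ℝ) ∈ Icc (-a) a :=
  ⟨fun i => by simpa using (h.pos i).le, fun i => (h.pos i).le⟩

theorem flow_zero (h : IsOrbit Λ x₀ X a U G) (i : Fin N) : G i 0 x₀ = x₀ := by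
  obtain ⟨T, -, hG⟩ := h.flow i
  exact hG.initial x₀ h.origin_mem

theorem flowComp_zero (h : IsOrbit Λ x₀ X a U G) : flowComp G x₀ 0 = x₀ := by
  induction N with
  | zero => exact flowComp_fin_zero x₀ G 0
  | succ N ih =>
    have : Fin.tail (0 : Fin (N + 1) → ℝ) = 0 := rfl
    rw [flowComp_succ, this, ih h.tail]
    exact h.flow_zero 0

theorem fderiv_flowComp_zero (h : IsOrbit Λ x₀ X a U G) (v : Fin N → ℝ) :
    fderiv ℝ (flowComp G x₀) 0 v = ∑ i, v i • X i x₀ := by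
  induction N with
  | zero =>
    have : flowComp G x₀ = fun _ => x₀ := funext fun t => flowComp_fin_zero x₀ G t
    simp [this]
  | succ N ih =>
    have ht : Fin.tail (0 : Fin (N + 1) → ℝ) = 0 := rfl
    obtain ⟨T, haT, hG⟩ := h.flow 0
    rw [(h.hasFDerivAt_succ h.zero_mem_Icc (h.tail.contDiffAt h.tail.zero_mem_Icc)).2, ht,
      h.flowComp_zero, h.tail.flowComp_zero, Pi.zero_apply,
      hG.fderiv_space_zero h.isOpen ((h.pos 0).trans haT) h.origin_mem, ih h.tail, Fin.sum_univ_succ]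
    rfl

/-- Along an orbit, the derivative in the parameters is tangent to `Λ`. -/
theorem fderiv_mem_valuesAt (h : IsOrbit Λ x₀ X a U G) {Y : Fin M → Rn n → Rn n}
    (hY : IsGeneratingSystem Λ x₀ Y) (hsm : ∀ X ∈ Λ, ContDiff ℝ ∞ X)
    (hbr : ∀ X ∈ Λ, ∀ Y ∈ Λ, VectorField.lieBracket ℝ X Y ∈ Λ)
    (hp : p ∈ Icc (-a) a) (v : Fin N → ℝ) :
    fderiv ℝ (flowComp G x₀) p v ∈ valuesAt Λ (flowComp G x₀ p) := by
  induction N with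
  | zero => rw [Subsingleton.elim v 0, map_zero]; exact zero_mem _
  | succ N ih =>
    have hpt : Fin.tail p ∈ Icc (-Fin.tail a) (Fin.tail a) := ⟨fun i => hp.1 _, fun i => hp.2 _⟩
    rw [(h.hasFDerivAt_succ hp (h.tail.contDiffAt hpt)).2]
    refine add_mem (Submodule.smul_mem _ _ (apply_mem_valuesAt (h.mem 0) _)) ?_
    rw [← hY.map_valuesAt hsm hbr h hp]
    exact Submodule.mem_map_of_mem (ih h.tail hpt _)

/-- The dimension of `Λ` is constant along orbits. -/
theorem finrank_valuesAt (h : IsOrbit Λ x₀ X a U G) {Y : Fin M → Rn n → Rn n}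
    (hY : IsGeneratingSystem Λ x₀ Y) (hsm : ∀ X ∈ Λ, ContDiff ℝ ∞ X)
    (hbr : ∀ X ∈ Λ, ∀ Y ∈ Λ, VectorField.lieBracket ℝ X Y ∈ Λ) (hp : p ∈ Icc (-a) a) :
    Module.finrank ℝ (valuesAt Λ (flowComp G x₀ p)) = Module.finrank ℝ (valuesAt Λ x₀) := by
  induction N with
  | zero => rw [flowComp_fin_zero]
  | succ N ih =>
    have hpt : Fin.tail p ∈ Icc (-Fin.tail a) (Fin.tail a) := ⟨fun i => hp.1 _, fun i => hp.2 _⟩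
    have hz : flowComp (fun i => G i.succ) x₀ (Fin.tail p) ∈ U := by
      have := h.stays p hp 0
      rwa [← partialComp_tail] at this
    obtain ⟨T, haT, hG⟩ := h.flow 0
    have hu := hG.isUnit_fderiv_space h.isOpen (hsm _ (h.mem 0)) (t := p 0)
      ⟨by linarith [show -a 0 ≤ p 0 from hp.1 0], by linarith [show p 0 ≤ a 0 from hp.2 0]⟩ hz
    rw [ContinuousLinearMap.isUnit_iff_isUnit_toLinearMap, LinearMap.isUnit_iff_ker_eq_bot,
      LinearMap.ker_eq_bot] at hu
    rw [← ih h.tail hpt, ← hY.map_valuesAt hsm hbr h hp]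
    exact (Submodule.equivMapOfInjective _ hu _).finrank_eq.symm

end IsOrbit

/-! ### Normalized generators -/

/-- Prepend fields `B i ∈ Λ` whose values form a basis of `Λ(x₀)`, and subtract from each `Y j` the
constant combination of them that agrees with it at `x₀`. Because the `d j i` are constants, the new
coefficients remain smooth. -/
theorem IsGeneratingSystem.exists_normalized {n M k : ℕ} {Λ : Submodule ℝ (Rn n → Rn n)}
    {x₀ : Rn n} {Y : Fin M → Rn n → Rn n} (hY : IsGeneratingSystem Λ x₀ Y)
    (hdim : Module.finrank ℝ (valuesAt Λ x₀) = k) :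
    ∃ Y' : Fin (k + M) → Rn n → Rn n, IsGeneratingSystem Λ x₀ Y' ∧
      LinearIndependent ℝ (fun i : Fin k => Y' (Fin.castAdd M i) x₀) ∧
      ∀ j : Fin M, Y' (Fin.natAdd k j) x₀ = 0 := by
  let b : Module.Basis (Fin k) ℝ (valuesAt Λ x₀) := Module.finBasisOfFinrankEq ℝ _ hdim
  choose B hB hBx using fun i => (b i).2
  let d : Fin M → Fin k → ℝ := fun j i => b.repr ⟨Y j x₀, apply_mem_valuesAt (hY.1 j) x₀⟩ i
  have hd : ∀ j, ∑ i, d j i • B i x₀ = Y j x₀ := fun j => by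
    have := congrArg Subtype.val (b.sum_repr ⟨Y j x₀, apply_mem_valuesAt (hY.1 j) x₀⟩)
    rw [Submodule.coe_sum] at this
    simp only [Submodule.coe_smul, ← hBx] at this
    exact this
  refine ⟨Fin.append B fun j => Y j - ∑ i, d j i • B i, ⟨fun j => ?_, ?_⟩, ?_, fun j => ?_⟩
  · refine Fin.addCases (fun i => ?_) (fun j => ?_) j
    · rw [Fin.append_left]; exact hB i
    · rw [Fin.append_right]
      exact sub_mem (hY.1 j) (Submodule.sum_mem _ fun i _ => Submodule.smul_mem _ _ (hB i))
  · intro Z hZ N X a U G h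
    obtain ⟨c, hc, hcZ⟩ := hY.2 Z hZ N X a U G h
    refine ⟨Fin.append (fun i p => ∑ j, c j p * d j i) c, fun j => ?_, fun p hp => ?_⟩
    · refine Fin.addCases (fun i => ?_) (fun j => ?_) j
      · rw [Fin.append_left]
        exact ContDiffOn.sum fun j _ => (hc j).mul contDiffOn_const
      · rw [Fin.append_right]; exact hc j
    · rw [hcZ p hp, Fin.sum_univ_add]
      simp only [Fin.append_left, Fin.append_right, Pi.sub_apply, Finset.sum_apply, Pi.smul_apply,
        smul_sub, Finset.sum_sub_distrib, Finset.sum_smul, Finset.smul_sum, smul_smul]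
      rw [Finset.sum_comm]
      abel
  · have := b.linearIndependent.map' (valuesAt Λ x₀).subtype (Submodule.ker_subtype _)
    have hfun : (fun i => Fin.append B (fun j => Y j - ∑ i, d j i • B i) (Fin.castAdd M i) x₀) =
        (valuesAt Λ x₀).subtype ∘ b := by
      funext i
      rw [Fin.append_left]
      exact hBx i
    rw [hfun]
    exact this
  · rw [Fin.append_right]
    simp [hd]

/-! ### Local analysis near the origin -/

/-- An immersion at `0` parametrizes, near `0`, the zero set of a submersion. -/
theorem exists_submersion_of_immersion {k n : ℕ} (hk : k ≤ n) {F : (Fin k → ℝ) → Rn n} {α₀ : ℝ}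
    (hα₀ : 0 < α₀) (hF : ∀ t ∈ ball 0 α₀, ContDiffAt ℝ ∞ F t)
    (hinj : Function.Injective (fderiv ℝ F 0)) :
    ∃ (α : ℝ) (W : Set (Rn n)) (f : Rn n → Rn (n - k)), 0 < α ∧ α ≤ α₀ ∧ IsOpen W ∧
      ContDiffOn ℝ ∞ f W ∧ (∀ y ∈ W, Function.Surjective (fderiv ℝ f y)) ∧
      F '' ball 0 α = {y ∈ W | f y = 0} ∧
      (∀ t ∈ ball 0 α, Function.Injective (fderiv ℝ F t)) ∧
      ∀ h : Rn n → Rn (n - k), ContDiffAt ℝ 1 h (F 0) → (∀ t ∈ ball 0 α, h (F t) = 0) →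
        ∃ K : ℝ, ∀ᶠ x in nhds (F 0), ‖h x‖ ≤ K * ‖f x‖ := by
  have h0 : (0 : Fin k → ℝ) ∈ ball 0 α₀ := mem_ball_self hα₀
  -- With `L` mapping onto a complement `Q` of the tangent space, `Ψ(t, w) = F(t) + L w` is a local
  -- diffeomorphism, and `f` is the `w`-component of its inverse.
  obtain ⟨Q, hQ⟩ := Submodule.exists_isCompl (LinearMap.range (fderiv ℝ F 0).toLinearMap)
  have hfr : Module.finrank ℝ (Rn (n - k)) = Module.finrank ℝ Q := by
    have h1 := Submodule.finrank_add_eq_of_isCompl hQ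
    rw [LinearMap.finrank_range_of_inj hinj] at h1
    simp at h1 ⊢
    omega
  let L : Rn (n - k) →L[ℝ] Rn n :=
    LinearMap.toContinuousLinearMap (Q.subtype ∘ₗ (LinearEquiv.ofFinrankEq _ _ hfr).toLinearMap)
  have hLQ : ∀ w, L w ∈ Q := fun w => (LinearEquiv.ofFinrankEq _ _ hfr w).2
  have hLinj : ∀ w, L w = 0 → w = 0 := fun w hw =>
    (LinearEquiv.map_eq_zero_iff (LinearEquiv.ofFinrankEq _ _ hfr)).1 (Subtype.ext hw)
  let D : (Fin k → ℝ) → ((Fin k → ℝ) × Rn (n - k) →L[ℝ] Rn n) := fun t => (fderiv ℝ F t).coprod L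
  have hD0 : Function.Injective (D 0).toLinearMap := by
    rw [← LinearMap.ker_eq_bot, LinearMap.ker_eq_bot']
    rintro ⟨v, w⟩ hvw
    have hvw' : fderiv ℝ F 0 v + L w = 0 := by simpa [D] using hvw
    have h1 : fderiv ℝ F 0 v = 0 := by
      refine (Submodule.disjoint_def.1 hQ.disjoint) _ ⟨v, rfl⟩ ?_
      rw [eq_neg_of_add_eq_zero_left hvw']
      exact neg_mem (hLQ w)
    rw [h1, zero_add] at hvw'
    rw [hLinj w hvw', hinj (h1.trans (map_zero _).symm)]
    rfl
  have hfr' : Module.finrank ℝ ((Fin k → ℝ) × Rn (n - k)) = Module.finrank ℝ (Rn n) := by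
    simp; omega
  let E0 : ((Fin k → ℝ) × Rn (n - k)) ≃L[ℝ] Rn n :=
    (LinearMap.linearEquivOfInjective (D 0).toLinearMap hD0 hfr').toContinuousLinearEquiv
  have hE0 : (E0 : ((Fin k → ℝ) × Rn (n - k)) →L[ℝ] Rn n) = D 0 := by
    refine ContinuousLinearMap.ext fun q => ?_; rfl
  let Ψ : (Fin k → ℝ) × Rn (n - k) → Rn n := fun q => F q.1 + L q.2
  have hΨ : ∀ q : (Fin k → ℝ) × Rn (n - k), q.1 ∈ ball 0 α₀ → ContDiffAt ℝ ∞ Ψ q := fun q hq =>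
    ((hF _ hq).comp q contDiffAt_fst).add (L.contDiff.comp contDiff_snd).contDiffAt
  have hΨ' : ∀ q : (Fin k → ℝ) × Rn (n - k), q.1 ∈ ball 0 α₀ → HasFDerivAt Ψ (D q.1) q := by
    intro q hq
    have h1 := ((hF _ hq).differentiableAt (by simp)).hasFDerivAt.comp q
      (hasFDerivAt_fst (𝕜 := ℝ) (p := q))
    have h2 := L.hasFDerivAt.comp q (hasFDerivAt_snd (𝕜 := ℝ) (p := q))
    refine (h1.add h2).congr_fderiv ?_
    refine ContinuousLinearMap.ext fun v => ?_
    simp [D]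
  have hc0 := hΨ (0, 0) h0
  have hd0 : HasFDerivAt Ψ (E0 : ((Fin k → ℝ) × Rn (n - k)) →L[ℝ] Rn n) (0, 0) := by
    rw [hE0]; exact hΨ' (0, 0) h0
  let e := hc0.toOpenPartialHomeomorph Ψ hd0 (by simp)
  have heΨ : ∀ q, e q = Ψ q := fun q => by
    rw [ContDiffAt.toOpenPartialHomeomorph_coe]
  have hsrc : e.source ∈ nhds ((0, 0) : (Fin k → ℝ) × Rn (n - k)) :=
    e.open_source.mem_nhds (ContDiffAt.mem_toOpenPartialHomeomorph_source hc0 hd0 (by simp))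
  have hDc : ContinuousAt (fun q : (Fin k → ℝ) × Rn (n - k) => D q.1) (0, 0) := by
    have h1 : ContinuousAt (fderiv ℝ F) 0 :=
      ((hF 0 h0).fderiv_right (m := 0) (by simp)).continuousAt
    have h2 : Continuous fun A : (Fin k → ℝ) →L[ℝ] Rn n => A.coprod L := by
      have : (fun A : (Fin k → ℝ) →L[ℝ] Rn n => A.coprod L) = fun A =>
          A.comp (ContinuousLinearMap.fst ℝ _ _) + L.comp (ContinuousLinearMap.snd ℝ _ _) := by
        funext A; refine ContinuousLinearMap.ext fun v => ?_; simp
      rw [this]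
      exact (continuous_id.clm_comp continuous_const).add continuous_const
    exact h2.continuousAt.comp (ContinuousAt.comp (f := Prod.fst) h1 continuous_fst.continuousAt)
  -- Smoothness of the inverse is needed on all of `W`, hence invertibility of the derivative at all
  -- nearby points.
  have hunit : ∀ᶠ q in nhds ((0, 0) : (Fin k → ℝ) × Rn (n - k)), D q.1 ∈
      range ((↑) : (((Fin k → ℝ) × Rn (n - k)) ≃L[ℝ] Rn n) → _) := by
    refine hDc.eventually ?_
    change ∀ᶠ y in nhds (D 0), y ∈ _
    rw [← hE0]
    exact E0.nhds
  obtain ⟨ε, hε, hball⟩ := Metric.mem_nhds_iff.1 (Filter.inter_mem hsrc hunit)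
  have hα : 0 < min ε α₀ := lt_min hε hα₀
  generalize hαe : min ε α₀ = α at hα
  have hαε : α ≤ ε := hαe ▸ min_le_left _ _
  have hαα₀ : α ≤ α₀ := hαe ▸ min_le_right _ _
  -- In the sup norm this ball is a product of balls, so the points of `P` with `w = 0` are exactly
  -- those with `t ∈ ball 0 α`.
  let P : Set ((Fin k → ℝ) × Rn (n - k)) := ball (0, 0) α
  have hP : ∀ q ∈ P, q ∈ e.source ∧ q.1 ∈ ball 0 α₀ ∧ D q.1 ∈
      range ((↑) : (((Fin k → ℝ) × Rn (n - k)) ≃L[ℝ] Rn n) → _) := by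
    intro q hq
    have h1 := hball (ball_subset_ball hαε hq)
    refine ⟨h1.1, ball_subset_ball hαα₀ ?_, h1.2⟩
    have : q ∈ ball (0 : Fin k → ℝ) α ×ˢ ball (0 : Rn (n - k)) α := by rwa [ball_prod_same]
    exact this.1
  have hPt : ∀ t ∈ ball (0 : Fin k → ℝ) α, (t, (0 : Rn (n - k))) ∈ P := fun t ht => by
    have : (t, (0 : Rn (n - k))) ∈ ball (0 : Fin k → ℝ) α ×ˢ ball (0 : Rn (n - k)) α :=
      ⟨ht, mem_ball_self hα⟩
    rwa [ball_prod_same] at this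
  have hPsub : P ⊆ e.source := fun q hq => (hP q hq).1
  let f : Rn n → Rn (n - k) := fun y => (e.symm y).2
  have hfΨ : ∀ q ∈ P, f (Ψ q) = q.2 := fun q hq => by
    rw [← heΨ]; exact congrArg Prod.snd (e.left_inv (hPsub hq))
  have hΨ0 : ∀ t, Ψ (t, 0) = F t := fun t => by simp [Ψ]
  have hsymm : ∀ q ∈ P, ContDiffAt ℝ ∞ e.symm (Ψ q) := by
    intro q hq
    obtain ⟨hs, hq0, A, hA⟩ := hP q hq
    have hq' : e.symm (Ψ q) = q := by rw [← heΨ]; exact e.left_inv hs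
    refine e.contDiffAt_symm (f₀' := A) (by rw [← heΨ]; exact e.map_source hs) ?_ ?_
    · rw [hq', hA]; exact (hΨ' q hq0)
    · rw [hq']; exact hΨ q hq0
  have hfP : ∀ q ∈ P, ContDiffAt ℝ ∞ f (Ψ q) := fun q hq => (hsymm q hq).snd
  refine ⟨α, e '' P, f, hα, hαα₀, e.isOpen_image_of_subset_source isOpen_ball hPsub, ?_, ?_, ?_, ?_,
    ?_⟩
  · rintro _ ⟨q, hq, rfl⟩
    exact (heΨ q ▸ hfP q hq).contDiffWithinAt
  · rintro _ ⟨q, hq, rfl⟩ w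
    rw [heΨ]
    have h1 := ((hfP q hq).differentiableAt (by simp)).hasFDerivAt.comp q (hΨ' q (hP q hq).2.1)
    have h2 : HasFDerivAt (f ∘ Ψ) (ContinuousLinearMap.snd ℝ (Fin k → ℝ) (Rn (n - k))) q := by
      refine hasFDerivAt_snd.congr_of_eventuallyEq ?_
      filter_upwards [isOpen_ball.mem_nhds hq] with q' hq'
      exact hfΨ q' hq'
    exact ⟨D q.1 (0, w), DFunLike.congr_fun (h1.unique h2) (0, w)⟩
  · ext y
    constructor
    · rintro ⟨t, ht, rfl⟩
      refine ⟨⟨(t, 0), hPt t ht, by rw [heΨ, hΨ0]⟩, ?_⟩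
      rw [← hΨ0, hfΨ _ (hPt t ht)]
    · rintro ⟨⟨q, hq, rfl⟩, hf⟩
      rw [heΨ, hfΨ q hq] at hf
      have : q ∈ ball (0 : Fin k → ℝ) α ×ˢ ball (0 : Rn (n - k)) α := by rwa [ball_prod_same]
      refine ⟨q.1, this.1, ?_⟩
      rw [heΨ, ← hΨ0, ← hf]
  · intro t ht v v' hv
    obtain ⟨-, -, A, hA⟩ := hP _ (hPt t ht)
    have : A (v, 0) = A (v', 0) := by
      have h1 := fun q => DFunLike.congr_fun hA q
      simp only [ContinuousLinearEquiv.coe_coe] at h1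
      rw [h1, h1]
      simpa [D] using hv
    exact congrArg Prod.fst (A.injective this)
  -- `h ∘ Ψ` is Lipschitz near the origin and vanishes at `(t, 0)`, which is at distance `‖w‖ = ‖f
  -- x‖` from `(t, w)`.
  · intro h hh hhF
    have h00 : ((0, 0) : (Fin k → ℝ) × Rn (n - k)) ∈ P := mem_ball_self hα
    have h1 : ContDiffAt ℝ 1 (fun q => h (Ψ q)) (0, 0) := by
      refine ContDiffAt.comp (0, 0) ?_ (hc0.of_le (by simp))
      rwa [hΨ0]
    obtain ⟨K, S, hS, hK⟩ := h1.exists_lipschitzOnWith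
    obtain ⟨η, hη, hηS⟩ := Metric.mem_nhds_iff.1 (Filter.inter_mem hS (isOpen_ball.mem_nhds h00))
    refine ⟨K, ?_⟩
    have hF0 : F 0 = e (0, 0) := by rw [heΨ, hΨ0]
    have htgt : F 0 ∈ e.target := by rw [hF0]; exact e.map_source (hPsub h00)
    have hes : Filter.Tendsto e.symm (nhds (F 0)) (nhds (0, 0)) := by
      have := e.symm.continuousAt (x := F 0) htgt
      rwa [ContinuousAt, show e.symm (F 0) = (0, 0) by rw [hF0]; exact e.left_inv (hPsub h00)]
        at this
    filter_upwards [hes.eventually (isOpen_ball.mem_nhds (mem_ball_self hη)),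
      e.open_target.mem_nhds htgt] with x hx hxt
    have hq : e.symm x ∈ ball (0 : Fin k → ℝ) η ×ˢ ball (0 : Rn (n - k)) η := by
      rw [ball_prod_same]; exact hx
    have hq' : ((e.symm x).1, (0 : Rn (n - k))) ∈ ball ((0, 0) : (Fin k → ℝ) × Rn (n - k)) η := by
      rw [← ball_prod_same]; exact ⟨hq.1, mem_ball_self hη⟩
    have hqP : (e.symm x).1 ∈ ball (0 : Fin k → ℝ) α := by
      have : ((e.symm x).1, (0 : Rn (n - k))) ∈ P := (hηS hq').2
      have : ((e.symm x).1, (0 : Rn (n - k))) ∈ ball (0 : Fin k → ℝ) α ×ˢ ball (0 : Rn (n - k)) α := by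
        rwa [ball_prod_same]
      exact this.1
    have h2 := hK.dist_le_mul _ (hηS hx).1 _ (hηS hq').1
    rw [hΨ0, hhF _ hqP, dist_zero_right, ← heΨ, e.right_inv hxt] at h2
    refine h2.trans (mul_le_mul_of_nonneg_left (le_of_eq ?_) K.2)
    rw [Prod.dist_eq]
    simp [f]

/-- Near a point where `Y₁, …, Y_k ∈ Λ` are independent, they form a frame of `Λ(x)` wherever the
latter has dimension `k`, with locally bounded coordinates. -/
theorem exists_bound_coordinates {n k : ℕ} {Λ : Submodule ℝ (Rn n → Rn n)} {x₀ : Rn n}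
    {Y : Fin k → Rn n → Rn n} (hY : ∀ i, Y i ∈ Λ) (hc : ∀ i, Continuous (Y i))
    (hli : LinearIndependent ℝ fun i => Y i x₀) :
    ∃ C : ℝ, 0 ≤ C ∧ ∀ᶠ x in nhds x₀, Module.finrank ℝ (valuesAt Λ x) = k →
      ∀ v ∈ valuesAt Λ x, ∃ b : Fin k → ℝ, ∑ i, b i • Y i x = v ∧ ‖b‖ ≤ C * ‖v‖ := by
  let A : Rn n → (Fin k → ℝ) →L[ℝ] Rn n := fun x =>
    ∑ i, (ContinuousLinearMap.proj i : (Fin k → ℝ) →L[ℝ] ℝ).smulRight (Y i x)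
  have hA : ∀ x b, A x b = ∑ i, b i • Y i x := fun x b => by simp [A]
  have hAc : Continuous A := continuous_finsetSum _ fun i _ =>
    (ContinuousLinearMap.smulRightL ℝ (Fin k → ℝ) (Rn n) _).continuous.comp (hc i)
  have hker : LinearMap.ker (A x₀).toLinearMap = ⊥ := by
    rw [LinearMap.ker_eq_bot']
    intro b hb
    funext i
    exact Fintype.linearIndependent_iff.1 hli b ((hA x₀ b).symm.trans hb) i
  obtain ⟨K, -, hK⟩ := LinearMap.exists_antilipschitzWith _ hker
  have hKb : ∀ b, ‖b‖ ≤ K * ‖A x₀ b‖ := fun b => by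
    simpa using hK.le_mul_dist b 0
  -- A perturbation of this size costs at most `‖b‖ / 2` in `hKb`, which is absorbed on the left;
  -- the `+ 1` allows `K = 0`.
  have hpos : 0 < 1 / (2 * ((K : ℝ) + 1)) := by positivity
  refine ⟨2 * K, by positivity, ?_⟩
  filter_upwards [hAc.continuousAt.eventually (ball_mem_nhds (A x₀) hpos)] with x hx hdim v hv
  have hx' : ‖A x₀ - A x‖ ≤ 1 / (2 * ((K : ℝ) + 1)) := by
    rw [← dist_eq_norm, dist_comm]; exact (mem_ball.1 hx).le
  have hbd : ∀ b, ‖b‖ ≤ 2 * K * ‖A x b‖ := by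
    intro b
    have h1 : ‖A x₀ b‖ ≤ ‖A x b‖ + 1 / (2 * ((K : ℝ) + 1)) * ‖b‖ := by
      calc ‖A x₀ b‖ = ‖A x b + (A x₀ - A x) b‖ := by simp
        _ ≤ ‖A x b‖ + ‖(A x₀ - A x) b‖ := norm_add_le _ _
        _ ≤ _ := by gcongr; exact (A x₀ - A x).le_of_opNorm_le hx' b
    have h2 : (K : ℝ) * (1 / (2 * ((K : ℝ) + 1))) ≤ 1 / 2 := by
      rw [mul_one_div, div_le_div_iff₀ (by positivity) (by norm_num)]
      linarith [K.2]
    have h3 := hKb b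
    have h4 := mul_le_mul_of_nonneg_left h1 K.2
    have h5 := mul_le_mul_of_nonneg_right h2 (norm_nonneg b)
    simp only [NNReal.val_eq_coe] at h4
    linarith
  have hinj : Function.Injective (A x).toLinearMap := by
    rw [← LinearMap.ker_eq_bot, LinearMap.ker_eq_bot']
    intro b hb
    have := hbd b
    rw [show A x b = 0 from hb, norm_zero, mul_zero] at this
    exact norm_le_zero_iff.1 this
  have hrange : LinearMap.range (A x).toLinearMap = valuesAt Λ x := by
    refine Submodule.eq_of_le_of_finrank_eq ?_ ?_
    · rintro _ ⟨b, rfl⟩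
      change A x b ∈ _
      rw [hA]
      exact Submodule.sum_mem _ fun i _ => Submodule.smul_mem _ _ (apply_mem_valuesAt (hY i) x)
    · rw [LinearMap.finrank_range_of_inj hinj, hdim]; simp
  rw [← hrange] at hv
  obtain ⟨b, rfl⟩ := hv
  exact ⟨b, (hA x b).symm, hbd b⟩

/-- If the values of a continuous map on a compact convex set come close to `x₀`, they do so along
segments issuing from a preimage of `x₀`. -/
theorem exists_segment_mapsTo {E F : Type*} [NormedAddCommGroup E] [NormedSpace ℝ E]
    [MetricSpace F] {D : Set E} (hD : IsCompact D) (hconv : Convex ℝ D) {y : E → F}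
    (hy : ContinuousOn y D) {x₀ : F} {N : Set F} (hN : N ∈ nhds x₀) :
    ∃ δ > 0, ∀ p ∈ D, y p ∈ ball x₀ δ → ∃ q ∈ D, y q = x₀ ∧ ∀ z ∈ segment ℝ q p, y z ∈ N := by
  obtain ⟨η, hη, hηN⟩ := Metric.mem_nhds_iff.1 hN
  obtain ⟨ε, hε, hεη⟩ := Metric.uniformContinuousOn_iff.1
    (hD.uniformContinuousOn_of_continuous hy) η hη
  -- Parameters outside `O` have a compact image missing `x₀`, so values close enough to `x₀` come
  -- only from parameters within `ε` of a preimage.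
  let O : Set E := ⋃ q ∈ {q ∈ D | y q = x₀}, ball q ε
  have hO : IsOpen O := isOpen_biUnion fun _ _ => isOpen_ball
  have hcl : IsClosed (y '' (D \ O)) := ((hD.diff hO).image_of_continuousOn
    (hy.mono sdiff_subset)).isClosed
  have hx₀ : x₀ ∈ (y '' (D \ O))ᶜ := by
    rintro ⟨q, ⟨hq, hqO⟩, hqx⟩
    exact hqO (mem_biUnion (show q ∈ {q ∈ D | y q = x₀} from ⟨hq, hqx⟩) (mem_ball_self hε))
  obtain ⟨δ, hδ, hδs⟩ := Metric.mem_nhds_iff.1 (hcl.isOpen_compl.mem_nhds hx₀)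
  refine ⟨δ, hδ, fun p hp hpδ => ?_⟩
  have hpO : p ∈ O := by
    by_contra hcon
    exact hδs hpδ ⟨p, ⟨hp, hcon⟩, rfl⟩
  simp only [O, mem_iUnion] at hpO
  obtain ⟨q, ⟨hq, hqx⟩, hpq⟩ := hpO
  refine ⟨q, hq, hqx, fun z hz => hηN ?_⟩
  rw [← hqx]
  refine hεη z (hconv.segment_subset hq hp hz) q hq ?_
  exact ((convex_ball q ε).segment_subset (mem_ball_self hε) hpq hz)

namespace IsOrbit

variable {n N M : ℕ} {Λ : Submodule ℝ (Rn n → Rn n)} {x₀ : Rn n} {X : Fin N → Rn n → Rn n}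
  {a : Fin N → ℝ} {U : Set (Rn n)} {G : Fin N → ℝ → Rn n → Rn n}

/-- Near its origin, an orbit lies in the zero set of any function `f` with `f(x₀) = 0` for which
the derivative along `Λ` is controlled by `f`. -/
theorem exists_forall_eq_zero (h : IsOrbit Λ x₀ X a U G) {Y : Fin M → Rn n → Rn n}
    (hY : IsGeneratingSystem Λ x₀ Y) (hsm : ∀ X ∈ Λ, ContDiff ℝ ∞ X)
    (hbr : ∀ X ∈ Λ, ∀ Y ∈ Λ, VectorField.lieBracket ℝ X Y ∈ Λ)
    {E : Type*} [NormedAddCommGroup E] [NormedSpace ℝ E] {f : Rn n → E} (hf0 : f x₀ = 0)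
    (hfd : ∀ᶠ x in nhds x₀, DifferentiableAt ℝ f x) {C : ℝ} (hC : 0 ≤ C)
    (hf : ∀ᶠ x in nhds x₀, Module.finrank ℝ (valuesAt Λ x) = Module.finrank ℝ (valuesAt Λ x₀) →
      ∀ v ∈ valuesAt Λ x, ‖fderiv ℝ f x v‖ ≤ C * ‖f x‖ * ‖v‖) :
    ∃ δ > 0, ∀ p ∈ Icc (-a) a, flowComp G x₀ p ∈ ball x₀ δ → f (flowComp G x₀ p) = 0 := by
  have hyc : ∀ p ∈ Icc (-a) a, ContDiffAt ℝ ∞ (flowComp G x₀) p := fun p hp => h.contDiffAt hp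
  obtain ⟨δ, hδ, hseg⟩ := exists_segment_mapsTo (isCompact_Icc (a := -a) (b := a))
    (convex_Icc (-a) a) (fun p hp => (hyc p hp).continuousAt.continuousWithinAt) (hfd.and hf)
  refine ⟨δ, hδ, fun p hp hpδ => ?_⟩
  -- The orbit may leave the neighbourhood and return, so the segment starts at a nearby preimage
  -- `q` of `x₀` rather than at parameter `0`; the local estimate then holds on all of it.
  obtain ⟨q, hq, hqx, hs⟩ := hseg p hp hpδ
  let γ : ℝ → Fin N → ℝ := fun s => q + s • (p - q)
  have hγ : ∀ s ∈ Icc (0 : ℝ) 1, γ s ∈ segment ℝ q p := fun s hs => by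
    rw [segment_eq_image']; exact ⟨s, hs, rfl⟩
  have hγD : ∀ s ∈ Icc (0 : ℝ) 1, γ s ∈ Icc (-a) a := fun s hs =>
    (convex_Icc (-a) a).segment_subset hq hp (hγ s hs)
  have hγ' : ∀ s, HasDerivAt γ (p - q) s := fun s => by
    have := ((hasDerivAt_id s).smul_const (p - q)).const_add q
    rwa [one_smul] at this
  let u : ℝ → Rn n := fun s => fderiv ℝ (flowComp G x₀) (γ s) (p - q)
  have huc : ContinuousOn u (Icc 0 1) := fun s hs => by
    have h1 : ContinuousAt (fderiv ℝ (flowComp G x₀)) (γ s) :=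
      ((hyc _ (hγD s hs)).fderiv_right (m := 0) (by simp)).continuousAt
    have h2 : ContinuousAt (fun s => fderiv ℝ (flowComp G x₀) (γ s)) s :=
      ContinuousAt.comp (f := γ) h1 (hγ' s).continuousAt
    exact (h2.clm_apply continuousAt_const).continuousWithinAt
  obtain ⟨B, hB⟩ := isCompact_Icc.exists_bound_of_continuousOn huc
  have key := eq_zero_of_norm_deriv_le_of_mem_Icc (f := fun s => f (flowComp G x₀ (γ s)))
    (f' := fun s => fderiv ℝ f (flowComp G x₀ (γ s)) (u s)) (K := C * B) (a := 0) (b := 1)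
    (t₀ := 0) (fun s hs' => ?_) (fun s hs' => ?_) (by simp) (by simp [γ, hqx, hf0]) 1 (by simp)
  · simpa [γ] using key
  · exact (hs _ (hγ s hs')).1.hasFDerivAt.comp_hasDerivAt s
      (((hyc _ (hγD s hs')).differentiableAt (by simp)).hasFDerivAt.comp_hasDerivAt s (hγ' s))
  · refine ((hs _ (hγ s hs')).2 (h.finrank_valuesAt hY hsm hbr (hγD s hs')) _
      (h.fderiv_mem_valuesAt hY hsm hbr (hγD s hs') (p - q))).trans ?_
    calc C * ‖f (flowComp G x₀ (γ s))‖ * ‖u s‖ ≤ C * ‖f (flowComp G x₀ (γ s))‖ * B := by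
          gcongr; exact hB s hs'
      _ = _ := by ring

end IsOrbit

/-! ### From the submersion to global functions -/

theorem inner_gradient_eq_fderiv {n : ℕ} (φ : Rn n → ℝ) (x v : Rn n) :
    ⟪∇ φ x, v⟫_ℝ = fderiv ℝ φ x v := by
  simp [gradient]

/-- A submersion `f` near `x₀` gives smooth functions on `ℝⁿ` that vanish away from `x₀` and whose
common zeros near `x₀` are those of `f`. -/
theorem exists_global_of_submersion {n l : ℕ} {x₀ : Rn n} {f : Rn n → Rn l} {δ : ℝ} (hδ : 0 < δ)
    (hf : ∀ x ∈ ball x₀ δ, ContDiffAt ℝ ∞ f x) :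
    ∃ φ : Fin l → Rn n → ℝ, (∀ j, ContDiff ℝ ∞ (φ j)) ∧
      (∀ x ∉ ball x₀ δ, ∀ j, φ j =ᶠ[nhds x] 0) ∧
      (∃ r > 0, r ≤ δ ∧ ∀ x ∈ ball x₀ r, ∀ j, φ j x = f x j) ∧
      ∃ c : Rn n → ℝ, c x₀ = 1 ∧ ∀ x ∈ ball x₀ δ, f x = 0 → ∀ j, φ j x = 0 ∧
        ∀ v, fderiv ℝ (φ j) x v = c x * fderiv ℝ f x v j := by
  let χ : ContDiffBump x₀ := ⟨δ / 4, δ / 2, by positivity, by linarith⟩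
  have hfj : ∀ x ∈ ball x₀ δ, ∀ j, ContDiffAt ℝ ∞ (fun x => f x j) x := fun x hx j =>
    (EuclideanSpace.proj (𝕜 := ℝ) j).contDiff.contDiffAt.comp x (hf x hx)
  have hout : ∀ x ∉ ball x₀ δ, ∀ j, (fun x => χ x * f x j) =ᶠ[nhds x] 0 := by
    intro x hx j
    have h1 : x ∉ tsupport χ := by
      rw [χ.tsupport_eq]
      exact fun h => hx (closedBall_subset_ball (by change δ / 2 < δ; linarith) h)
    filter_upwards [notMem_tsupport_iff_eventuallyEq.1 h1] with y hy
    rw [hy]; simp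
  refine ⟨fun j x => χ x * f x j, fun j => ?_, hout, ⟨δ / 4, by positivity, by linarith, ?_⟩, χ,
    χ.one_of_mem_closedBall (mem_closedBall_self (by positivity)), ?_⟩
  · refine contDiff_iff_contDiffAt.2 fun x => ?_
    by_cases hx : x ∈ ball x₀ δ
    · exact χ.contDiffAt.mul (hfj x hx j)
    · exact contDiffAt_const.congr_of_eventuallyEq (hout x hx j)
  · intro x hx j
    change χ x * f x j = f x j
    rw [χ.one_of_mem_closedBall (ball_subset_closedBall hx), one_mul]
  -- Where `f = 0`, the term containing the derivative of `χ` drops out, so only the factor `χ x`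
  -- remains.
  · intro x hx hfx j
    refine ⟨by simp [hfx], fun v => ?_⟩
    have h1 := (χ.contDiffAt (n := 1) (x := x)).differentiableAt (by simp)
    have h2 : HasFDerivAt (fun x => f x j) ((EuclideanSpace.proj (𝕜 := ℝ) j).comp (fderiv ℝ f x)) x :=
      (EuclideanSpace.proj (𝕜 := ℝ) j).hasFDerivAt.comp x
        ((hf x hx).differentiableAt (by simp)).hasFDerivAt
    have h3 : fderiv ℝ (fun x => χ x * f x j) x = _ := (h1.hasFDerivAt.mul h2).fderiv
    rw [h3]
    simp [hfx]

/-! ### Local structure of the orbit and conclusion -/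

theorem orbitManifold_eq_image {n k r : ℕ} {G : Fin (k + r) → ℝ → Rn n → Rn n} {x₀ : Rn n}
    (h0 : ∀ i, G (Fin.natAdd k i) 0 x₀ = x₀) {α : ℝ} (hα : 0 < α) :
    orbitManifold G x₀ α = (fun t : Fin k → ℝ => flowComp G x₀ (Fin.append t 0)) '' ball 0 α := by
  ext x
  simp only [orbitManifold, mem_ofPred_eq, mem_image, mem_ball_zero_iff, pi_norm_lt_iff hα,
    Real.norm_eq_abs, flowComp_append_zero x₀ G h0, eq_comm (a := x)]

/-- Local structure of an orbit along the flows of a normalized system of generators. -/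
theorem exists_submersion_of_orbit {n k r : ℕ} (hk : k ≤ n) {Λ : Submodule ℝ (Rn n → Rn n)}
    {x₀ : Rn n} (hsm : ∀ X ∈ Λ, ContDiff ℝ ∞ X)
    (hbr : ∀ X ∈ Λ, ∀ Y ∈ Λ, VectorField.lieBracket ℝ X Y ∈ Λ)
    (hdim : Module.finrank ℝ (valuesAt Λ x₀) = k) {Y : Fin (k + r) → Rn n → Rn n}
    (hY : IsGeneratingSystem Λ x₀ Y)
    (hli : LinearIndependent ℝ fun i : Fin k => Y (Fin.castAdd r i) x₀)
    {a : Fin (k + r) → ℝ} {U : Set (Rn n)} {G : Fin (k + r) → ℝ → Rn n → Rn n}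
    (h : IsOrbit Λ x₀ Y a U G) {ρ : ℝ} (hρ : 0 < ρ) :
    ∃ (α : ℝ) (W : Set (Rn n)) (f : Rn n → Rn (n - k)), 0 < α ∧ IsOpen W ∧ x₀ ∈ W ∧
      ContDiffOn ℝ ∞ f W ∧ (∀ y ∈ W, Function.Surjective (fderiv ℝ f y)) ∧
      orbitManifold G x₀ α = {y ∈ W | f y = 0} ∧ orbitManifold G x₀ α ⊆ orbitSet G a x₀ ρ ∧
      (∀ x ∈ orbitManifold G x₀ α, ∀ v ∈ valuesAt Λ x, fderiv ℝ f x v = 0) ∧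
      ∃ δ > 0, ball x₀ δ ⊆ W ∧
        ∀ p ∈ Icc (-a) a, flowComp G x₀ p ∈ ball x₀ δ → f (flowComp G x₀ p) = 0 := by
  let ι : (Fin k → ℝ) →L[ℝ] (Fin (k + r) → ℝ) := ContinuousLinearMap.pi
    (Fin.append (fun i => ContinuousLinearMap.proj i) (fun _ : Fin r => 0))
  have hι : ∀ t, ι t = Fin.append t 0 := fun t => by
    funext i
    refine Fin.addCases (fun i => ?_) (fun i => ?_) i <;> simp [ι]
  let F : (Fin k → ℝ) → Rn n := fun t => flowComp G x₀ (ι t)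
  have hF0 : F 0 = x₀ := by
    simp only [F, map_zero]; exact h.flowComp_zero
  have hFc : ∀ t, ι t ∈ Icc (-a) a → ContDiffAt ℝ ∞ F t := fun t ht =>
    ContDiffAt.comp t (h.contDiffAt ht) ι.contDiff.contDiffAt
  have hFd : ∀ t, ι t ∈ Icc (-a) a → ∀ v, fderiv ℝ F t v =
      fderiv ℝ (flowComp G x₀) (ι t) (ι v) := fun t ht v => by
    have := (((h.contDiffAt ht).differentiableAt (by simp)).hasFDerivAt.comp t
      ι.hasFDerivAt).fderiv
    exact DFunLike.congr_fun this v
  have hι0 : ι 0 ∈ Icc (-a) a := by rw [map_zero]; exact h.zero_mem_Icc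
  have hev : ∀ᶠ t in nhds (0 : Fin k → ℝ), ι t ∈ Icc (-a) a ∧ F t ∈ ball x₀ ρ := by
    refine (ι.continuous.continuousAt.eventually ?_).and
      ((hFc 0 hι0).continuousAt.eventually ?_)
    · rw [map_zero]
      exact pi_Icc_mem_nhds (fun i => by simpa using h.pos i) (fun i => h.pos i)
    · rw [hF0]; exact ball_mem_nhds _ hρ
  obtain ⟨α₀, hα₀, hball⟩ := Metric.mem_nhds_iff.1 hev
  have hinj : Function.Injective (fderiv ℝ F 0) := by
    refine (injective_iff_map_eq_zero (fderiv ℝ F 0)).2 fun v hv => ?_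
    rw [hFd 0 hι0, map_zero, h.fderiv_flowComp_zero, hι, Fin.sum_univ_add] at hv
    simp only [Fin.append_left, Fin.append_right, Pi.zero_apply, zero_smul,
      Finset.sum_const_zero, add_zero] at hv
    exact funext (Fintype.linearIndependent_iff.1 hli v hv)
  obtain ⟨α, W, f, hα, hαα₀, hW, hf, hsurj, hM, himm, hlip⟩ :=
    exists_submersion_of_immersion hk hα₀ (fun t ht => hFc t (hball ht).1) hinj
  have hbα : ∀ t ∈ ball (0 : Fin k → ℝ) α, ι t ∈ Icc (-a) a ∧ F t ∈ ball x₀ ρ := fun t ht =>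
    hball (ball_subset_ball hαα₀ ht)
  have hman : orbitManifold G x₀ α = F '' ball 0 α := by
    rw [orbitManifold_eq_image (fun i => h.flow_zero _) hα]
    simp only [F, hι]
  have hFW : ∀ t ∈ ball (0 : Fin k → ℝ) α, F t ∈ W ∧ f (F t) = 0 := fun t ht => by
    have : F t ∈ F '' ball 0 α := mem_image_of_mem F ht
    rwa [hM] at this
  have h0α : (0 : Fin k → ℝ) ∈ ball 0 α := mem_ball_self hα
  have hx₀W : x₀ ∈ W := hF0 ▸ (hFW 0 h0α).1
  have hfx₀ : f x₀ = 0 := hF0 ▸ (hFW 0 h0α).2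
  have hfW : ∀ x ∈ W, ContDiffAt ℝ ∞ f x := fun x hx => hf.contDiffAt (hW.mem_nhds hx)
  -- The range of `dF` lies in `Λ(F t)` and both have dimension `k`, so they coincide; then
  -- differentiate `f ∘ F = 0`.
  have hkill : ∀ t ∈ ball (0 : Fin k → ℝ) α, ∀ v ∈ valuesAt Λ (F t), fderiv ℝ f (F t) v = 0 := by
    intro t ht v hv
    have hrange : LinearMap.range (fderiv ℝ F t).toLinearMap = valuesAt Λ (F t) := by
      refine Submodule.eq_of_le_of_finrank_eq ?_ ?_
      · rintro _ ⟨w, rfl⟩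
        change fderiv ℝ F t w ∈ _
        rw [hFd t (hbα t ht).1]
        exact h.fderiv_mem_valuesAt hY hsm hbr (hbα t ht).1 _
      · rw [LinearMap.finrank_range_of_inj (himm t ht),
          h.finrank_valuesAt hY hsm hbr (hbα t ht).1, hdim]
        simp
    rw [← hrange] at hv
    obtain ⟨w, rfl⟩ := hv
    have h1 := ((hfW _ (hFW t ht).1).differentiableAt (by simp)).hasFDerivAt.comp t
      ((hFc t (hbα t ht).1).differentiableAt (by simp)).hasFDerivAt
    have h2 : HasFDerivAt (f ∘ F) (0 : (Fin k → ℝ) →L[ℝ] Rn (n - k)) t := by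
      refine (hasFDerivAt_const (0 : Rn (n - k)) t).congr_of_eventuallyEq ?_
      filter_upwards [isOpen_ball.mem_nhds ht] with s hs
      exact (hFW s hs).2
    exact DFunLike.congr_fun (h1.unique h2) w
  obtain ⟨C, hC, hCb⟩ := exists_bound_coordinates (Λ := Λ) (x₀ := x₀) (fun i => hY.1 (Fin.castAdd r i))
    (fun i => (hsm _ (hY.1 _)).continuous) hli
  -- `df(Y_i)` is a `C¹` function vanishing on the image of `F`, so `hlip` bounds it by `‖f‖`.
  have hK : ∀ i : Fin k, ∃ K : ℝ, ∀ᶠ x in nhds x₀,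
      ‖fderiv ℝ f x (Y (Fin.castAdd r i) x)‖ ≤ K * ‖f x‖ := by
    intro i
    have := hlip (fun x => fderiv ℝ f x (Y (Fin.castAdd r i) x)) ?_
      fun t ht => hkill t ht _ (apply_mem_valuesAt (hY.1 _) _)
    · rwa [hF0] at this
    · rw [hF0]
      exact ((hfW _ hx₀W).fderiv_right (m := 1) (by norm_num; exact ENat.LEInfty.out)).clm_apply
        ((hsm _ (hY.1 _)).contDiffAt.of_le ENat.LEInfty.out)
  choose K hK using hK
  have hest : ∀ᶠ x in nhds x₀, Module.finrank ℝ (valuesAt Λ x) =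
      Module.finrank ℝ (valuesAt Λ x₀) →
      ∀ v ∈ valuesAt Λ x, ‖fderiv ℝ f x v‖ ≤ (C * ∑ i, |K i|) * ‖f x‖ * ‖v‖ := by
    filter_upwards [hCb, Filter.eventually_all.2 hK] with x hx hxK hxd v hv
    obtain ⟨b, rfl, hb⟩ := hx (hxd.trans hdim) v hv
    set v := ∑ i, b i • Y (Fin.castAdd r i) x with hvdef
    have : fderiv ℝ f x v = ∑ i, b i • fderiv ℝ f x (Y (Fin.castAdd r i) x) := by
      rw [hvdef, map_sum]; simp
    calc ‖fderiv ℝ f x v‖ ≤ ∑ i, (C * ‖v‖) * (|K i| * ‖f x‖) := by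
          rw [this]
          refine norm_sum_le_of_le _ fun i _ => ?_
          rw [norm_smul]
          refine mul_le_mul ((norm_le_pi_norm b i).trans hb) ((hxK i).trans ?_) (norm_nonneg _)
            (by positivity)
          gcongr
          exact le_abs_self _
      _ = _ := by rw [← Finset.mul_sum, ← Finset.sum_mul]; ring
  obtain ⟨δ, hδ, hδf⟩ := h.exists_forall_eq_zero hY hsm hbr hfx₀
    (by filter_upwards [hW.mem_nhds hx₀W] with x hx using (hfW x hx).differentiableAt (by simp))
    (C := C * ∑ i, |K i|) (by positivity) hest
  obtain ⟨δ', hδ', hδW⟩ := Metric.mem_nhds_iff.1 (hW.mem_nhds hx₀W)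
  refine ⟨α, W, f, hα, hW, hx₀W, hf, hsurj, hman.trans hM, ?_, ?_, min δ δ', lt_min hδ hδ',
    (ball_subset_ball (min_le_right _ _)).trans hδW,
    fun p hp hpδ => hδf p hp (ball_subset_ball (min_le_left _ _) hpδ)⟩
  · rw [hman]
    rintro _ ⟨t, ht, rfl⟩
    exact ⟨(hbα t ht).2, ι t, (hbα t ht).1, rfl⟩
  · rw [hman]
    rintro _ ⟨t, ht, rfl⟩
    exact hkill t ht

theorem mainTheorem8 {n m k : ℕ} (g : Fin m → Rn n → Rn n) (hg : ∀ i, ContDiff ℝ ∞ (g i))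
    (x₀ : Rn n)
    (hfg : IsFinitelyGeneratedAlongOrbits (generatedLieAlgebra g) x₀)
    (hdim : Module.finrank ℝ (valuesAt (generatedLieAlgebra g) x₀) = k) (hk : k < n) :
    -- normalized systems of generators exist
    (∃ (r : ℕ) (Y : Fin (k + r) → Rn n → Rn n),
      IsGeneratingSystem (generatedLieAlgebra g) x₀ Y ∧
      LinearIndependent ℝ (fun i : Fin k => Y (Fin.castAdd r i) x₀) ∧
      ∀ j : Fin r, Y (Fin.natAdd k j) x₀ = 0) ∧
    -- and for each of them, along each of its orbits, the system has `n - k` nontrivial solutions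
    ∀ (r : ℕ) (Y : Fin (k + r) → Rn n → Rn n),
      IsGeneratingSystem (generatedLieAlgebra g) x₀ Y →
      LinearIndependent ℝ (fun i : Fin k => Y (Fin.castAdd r i) x₀) →
      (∀ j : Fin r, Y (Fin.natAdd k j) x₀ = 0) →
      ∀ (a : Fin (k + r) → ℝ) (U : Set (Rn n)) (G : Fin (k + r) → ℝ → Rn n → Rn n),
        IsOrbit (generatedLieAlgebra g) x₀ Y a U G →
        ∀ ρ : ℝ, 0 < ρ →
          ∃ φ : Fin (n - k) → Rn n → ℝ,
            (∀ j, ContDiffOn ℝ ∞ (φ j) (ball x₀ ρ)) ∧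
            (∀ j, ¬ ∃ c, ∀ x ∈ ball x₀ ρ, φ j x = c) ∧
            LinearIndependent ℝ (fun j => ∇ (φ j) x₀) ∧
            (∀ j, ∀ x ∈ orbitSet G a x₀ ρ, φ j x = 0) ∧
            (∀ j, ∀ x ∈ orbitSet G a x₀ ρ, ∀ i, ⟪∇ (φ j) x, g i x⟫_ℝ = 0) ∧
            ∃ α > 0, orbitManifold G x₀ α ⊆ orbitSet G a x₀ ρ ∧
              IsSmoothSubmanifold k (orbitManifold G x₀ α) ∧
              ∃ δ > 0, ∀ x ∈ ball x₀ δ,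
                (x ∈ orbitSet G a x₀ ρ ↔ x ∈ orbitManifold G x₀ α) ∧
                (x ∈ orbitManifold G x₀ α ↔ ∀ j, φ j x = 0) := by
  have hsm : ∀ X ∈ generatedLieAlgebra g, ContDiff ℝ ∞ X := fun X hX =>
    contDiff_of_mem_generatedLieAlgebra hg hX
  have hbr : ∀ X ∈ generatedLieAlgebra g, ∀ Y ∈ generatedLieAlgebra g,
      VectorField.lieBracket ℝ X Y ∈ generatedLieAlgebra g := fun X hX Y hY =>
    lieBracket_mem_generatedLieAlgebra hX hY
  obtain ⟨M, Y₀, hY₀⟩ := hfg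
  refine ⟨⟨M, hY₀.exists_normalized hdim⟩, fun r Y hY hli _ a U G h ρ hρ => ?_⟩
  obtain ⟨α, W, f, hα, hW, hx₀W, hf, hsurj, hM, hMV, hkill, δ, hδ, hδW, hδf⟩ :=
    exists_submersion_of_orbit hk.le hsm hbr hdim hY hli h hρ
  obtain ⟨φ, hφ, hφout, ⟨δ', hδ', hδδ', hφf⟩, c, hc, hφc⟩ := exists_global_of_submersion hδ
    fun x hx => hf.contDiffAt (hW.mem_nhds (hδW hx))
  have hVf : ∀ x ∈ orbitSet G a x₀ ρ, x ∈ ball x₀ δ → f x = 0 := by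
    rintro x ⟨-, p, hp, rfl⟩ hx
    exact hδf p hp hx
  have hmem : ∀ x ∈ ball x₀ δ, (x ∈ orbitManifold G x₀ α ↔ f x = 0) := fun x hx => by
    rw [hM]
    exact ⟨fun h => h.2, fun h => ⟨hδW hx, h⟩⟩
  have hfx₀ : f x₀ = 0 := by
    have := hδf 0 h.zero_mem_Icc
    rw [h.flowComp_zero] at this
    exact this (mem_ball_self hδ)
  have hdφ : ∀ j v, fderiv ℝ (φ j) x₀ v = fderiv ℝ f x₀ v j := fun j v => by
    rw [(hφc x₀ (mem_ball_self hδ) hfx₀ j).2, hc, one_mul]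
  refine ⟨φ, fun j => (hφ j).contDiffOn, ?_, ?_, ?_, ?_, α, hα, hMV, ⟨hk.le, fun x hx => ?_⟩,
    δ', hδ', fun x hx => ?_⟩
  -- A direction sent by `df` to the `j`-th basis vector gives `φ j` derivative `1` at `x₀`.
  · rintro j ⟨b, hb⟩
    obtain ⟨v, hv⟩ := hsurj x₀ hx₀W (EuclideanSpace.single j 1)
    have h1 : φ j =ᶠ[nhds x₀] fun _ => b := by
      filter_upwards [ball_mem_nhds x₀ hρ] with x hx using hb x hx
    have h2 := hdφ j v
    rw [h1.fderiv_eq, hv] at h2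
    simp at h2
  · rw [Fintype.linearIndependent_iff]
    intro b hb j
    obtain ⟨v, hv⟩ := hsurj x₀ hx₀W (EuclideanSpace.single j 1)
    have h1 := congrArg (fun w => ⟪w, v⟫_ℝ) hb
    simp only [sum_inner, real_inner_smul_left, inner_gradient_eq_fderiv, hdφ, hv,
      inner_zero_left] at h1
    simpa using h1
  -- Orbit points in `ball x₀ δ` satisfy `f = 0`; near any point outside that ball `φ j` is
  -- identically zero.
  · intro j x hx
    by_cases hxδ : x ∈ ball x₀ δ
    · exact (hφc x hxδ (hVf x hx hxδ) j).1
    · exact (hφout x hxδ j).eq_of_nhds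
  · intro j x hx i
    rw [inner_gradient_eq_fderiv]
    by_cases hxδ : x ∈ ball x₀ δ
    · have hfx := hVf x hx hxδ
      rw [(hφc x hxδ hfx j).2, hkill x ((hmem x hxδ).2 hfx) _
        (apply_mem_valuesAt (mem_generatedLieAlgebra i) x)]
      simp
    · rw [(hφout x hxδ j).fderiv_eq]
      simp
  · rw [hM] at hx ⊢
    refine ⟨W, f, hW, hx.1, hf, hsurj, ?_⟩
    rw [inter_eq_left]
    exact fun y hy => hy.1
  · have hxδ := ball_subset_ball hδδ' hx
    refine ⟨⟨fun hxV => (hmem x hxδ).2 (hVf x hxV hxδ), fun hxM => hMV hxM⟩, ?_⟩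
    rw [hmem x hxδ]
    simp only [hφf x hx]
    exact ⟨fun h j => by rw [h]; rfl, fun h => by ext j; exact h j⟩
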